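/- Let $\mathbb{F}=\mathbb{Z}/2\mathbb{Z}$. Let $(K_1,\tau_1)$ and $(K_2,\tau_2)$ be strongly invertible knots with transvergent diagrams $D_1$ and $D_2$, that is, knot diagrams which the involution (rotation by $\pi$ about an axis in the plane of projection, which reverses the orientation of the knot and meets it in two points) maps to themselves by reflecting the plane across the axis and exchanging upper and lower strands. For a transvergent diagram $D$ and a complete resolution $D_v$ with set of circles $Z(D_v)$, let $A_v=\mathbb{F}[u][x_c : c\in Z(D_v)]/(x_c^2=ux_c)$. The Bar-Natan complex of $D$ is $\bigoplus_v A_v$, with differential the sum over the edges $v\to w$ of the cube of resolutions of the following maps: for a merge, the algebra map induced by $Z(D_v)\to Z(D_w)$; for a split of $c_\alpha$ into $c_\beta$ and $c_\gamma$, the algebra map that sends $x_\alpha$ to $x_\beta$ and is the identity on all other circles, followed by multiplication by $x_\beta+x_\gamma+u$. With $\ell$ the number of factors $x_c$ of a squarefree monomial in $A_v$, the bigrading of this monomial is $(|v|-n_-,\ |Z(D_v)|-2\ell+|v|+n_+-2n_-)$, and $u$ has bigrading $(0,-2)$. The involution permutes the resolutions and their circles, and hence acts on this complex. The reduced complex $\mathit{Kcr}^-(D)$,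 with the induced action of $\tau$, is either of the following invariant subcomplexes: the unpointed one, which consists at $v$ of the subalgebra generated by all $x_c+x_{c'}$, with the quantum grading shifted by $-1$; or, for a point $p$ of the knot on the axis, the pointed one, which consists at $v$ of the multiples of $x_{c_p}$, where $c_p$ is the circle through $p$, with the quantum grading shifted by $+1$. (With these shifts the reduced complex of the crossingless diagram of the unknot is generated in bigrading $(0,0)$.) Let $p_1$ and $p_2$ be points of $K_1$ and $K_2$ on the respective axes, and let $D_1\# D_2$ be an equivariant connected sum of $D_1$ and $D_2$ along $p_1$ and $p_2$, formed in either of the two equivariant ways to join the four ends that arise when the knots are cut at these points. Then, for every choice among the constructions of the three reduced complexes, there is an isomorphism of bigraded complexes over $\mathbb{F}[u]$ $$\mathit{Kcr}^-(D_1\# D_2)\ \cong\ \mathit{Kcr}^-(D_1)\otimes_{\mathbb{F}[u]}\mathit{Kcr}^-(D_2)$$ which intertwines the involution $\tau_1\#\tau_2$ on the left with the diagonal involution $\tau_1\otimes\tau_2$ on the right. -/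

import Mathlib

open scoped TensorProduct

/-! ### The ground ring and the algebra of a collection of circles -/

/-- The ground ring `𝔽[u]`, where `𝔽 = ℤ/2ℤ`. -/
abbrev BNRing : Type := Polynomial (ZMod 2)

/-- The variable `u` of `𝔽[u]`. -/
noncomputable def BNRing.u : BNRing := Polynomial.X

/-- The ideal generated by the elements `x_c ^ 2 - u x_c`, for `c` in `Z`. -/
noncomputable def circleIdeal (Z : Type) : Ideal (MvPolynomial Z BNRing) :=
  Ideal.span (Set.range fun c : Z =>
    (MvPolynomial.X c ^ 2 - MvPolynomial.C BNRing.u * MvPolynomial.X c :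
      MvPolynomial Z BNRing))

/-- The algebra `𝔽[u][x_c : c ∈ Z] / (x_c ^ 2 = u x_c)`. The squarefree monomial
`x_{c_1} ⋯ x_{c_k}` is the generator of the tensor product of copies of the Frobenius algebra
`𝔽[u]{1, x}` in which `c_1, …, c_k` are labelled `x` and all other circles are labelled `1`. -/
def CircleAlgebra (Z : Type) : Type := MvPolynomial Z BNRing ⧸ circleIdeal Z

noncomputable instance (Z : Type) : CommRing (CircleAlgebra Z) :=
  inferInstanceAs (CommRing (MvPolynomial Z BNRing ⧸ circleIdeal Z))

noncomputable instance (Z : Type) : Algebra BNRing (CircleAlgebra Z) :=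
  inferInstanceAs (Algebra BNRing (MvPolynomial Z BNRing ⧸ circleIdeal Z))

namespace CircleAlgebra

/-- The generator `x_c`. -/
noncomputable def x {Z : Type} (c : Z) : CircleAlgebra Z :=
  Ideal.Quotient.mk (circleIdeal Z) (MvPolynomial.X c)

/-- The element `u` of the algebra. -/
noncomputable def u (Z : Type) : CircleAlgebra Z :=
  algebraMap BNRing (CircleAlgebra Z) BNRing.u

/-- The generator in which the circles of `S` are labelled `x` and all others `1`. -/
noncomputable def gen {Z : Type} (S : Finset Z) : CircleAlgebra Z := ∏ c ∈ S, x c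

theorem x_sq {Z : Type} (c : Z) : x c * x c = u Z * x c := by
  have h : (MvPolynomial.X c ^ 2 - MvPolynomial.C BNRing.u * MvPolynomial.X c :
      MvPolynomial Z BNRing) ∈ circleIdeal Z := Ideal.subset_span ⟨c, rfl⟩
  have h2 := (Ideal.Quotient.eq_zero_iff_mem).2 h
  rw [map_sub, sub_eq_zero, map_pow, map_mul, sq] at h2
  exact h2

theorem two_mul_eq_zero {Z : Type} (a : CircleAlgebra Z) : a + a = 0 := by
  have h : (1 : BNRing) + 1 = 0 := by
    have : (2 : BNRing) = 0 := CharTwo.two_eq_zero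
    rw [one_add_one_eq_two, this]
  calc a + a = ((1 : BNRing) + 1) • a := by rw [add_smul, one_smul]
    _ = 0 := by rw [h, zero_smul]

/-- The algebra map induced by a (not necessarily injective or surjective) relabelling of
circles. -/
noncomputable def relabel {Z Z' : Type} (f : Z → Z') :
    CircleAlgebra Z →ₐ[BNRing] CircleAlgebra Z' :=
  Ideal.Quotient.liftₐ (circleIdeal Z) (MvPolynomial.aeval fun c => x (f c)) (by
    intro a ha
    have hle : circleIdeal Z ≤ RingHom.ker (MvPolynomial.aeval (R := BNRing)
        (fun c : Z => (x (f c) : CircleAlgebra Z'))) := by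
      refine Ideal.span_le.2 ?_
      rintro _ ⟨c, rfl⟩
      simp only [SetLike.mem_coe, RingHom.mem_ker, map_sub, map_pow, map_mul,
        MvPolynomial.aeval_X, MvPolynomial.aeval_C]
      rw [sq, x_sq, u, sub_self]
    exact hle ha)

@[simp] theorem relabel_x {Z Z' : Type} (f : Z → Z') (c : Z) :
    relabel f (x c) = x (f c) := by
  have h : relabel f (x c) = MvPolynomial.aeval (R := BNRing)
      (fun c : Z => (x (f c) : CircleAlgebra Z')) (MvPolynomial.X c) := rfl
  rw [h, MvPolynomial.aeval_X]

/-- The subalgebra generated by `1` and the sums `x_c + x_{c'}`. -/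
noncomputable def unpointed (Z : Type) : Subalgebra BNRing (CircleAlgebra Z) :=
  Algebra.adjoin BNRing (Set.range fun c : Z × Z => x c.1 + x c.2)

theorem add_mem_unpointed {Z : Type} (c c' : Z) : x c + x c' ∈ unpointed Z :=
  Algebra.subset_adjoin ⟨(c, c'), rfl⟩

theorem relabel_mem_unpointed {Z Z' : Type} (f : Z → Z') {a : CircleAlgebra Z}
    (ha : a ∈ unpointed Z) : relabel f a ∈ unpointed Z' := by
  have h : unpointed Z ≤ (unpointed Z').comap (relabel f) := by
    refine Algebra.adjoin_le ?_
    rintro _ ⟨c, rfl⟩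
    simpa using add_mem_unpointed (f c.1) (f c.2)
  exact h ha

/-- The span of the generators in which `c` is labelled `x`, that is, the image of
multiplication by `x_c`. -/
noncomputable def pointed {Z : Type} (c : Z) : Submodule BNRing (CircleAlgebra Z) :=
  LinearMap.range (LinearMap.mulLeft BNRing (x c))

theorem mem_pointed {Z : Type} {c : Z} {a : CircleAlgebra Z} :
    a ∈ pointed c ↔ ∃ b, x c * b = a := Iff.rfl

theorem split_mul {Z : Type} (c c' : Z) :
    (x c + x c' + u Z) * x c = (x c + x c' + u Z) * x c' := by
  have h1 := x_sq c
  have h2 := x_sq c'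
  have h3 := two_mul_eq_zero (u Z * x c)
  have h4 := two_mul_eq_zero (u Z * x c')
  linear_combination h1 - h2 + h3 - h4

end CircleAlgebra

/-! ### Knot diagrams -/

/-- An oriented knot diagram, given by its signed Gauss code. The knot is cut into edges at the
crossings (once on each strand) and at finitely many further marked points. Every edge runs
from its tail to its head, and `next e` is the edge that starts at the head of `e`.

At a crossing `c` turn the picture so that the lower strand runs from south to north. The
four edge ends at `c`, counterclockwise from the south, are those of `lower c`, `east c`,
`next (lower c)` and `west c`; this is the planar diagram code of `c`. The predicate `IsPlanar`
below says that the code is that of a diagram on the sphere. -/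
structure KnotDiagram where
  /-- The crossings. -/
  Crossing : Type
  /-- The edges. -/
  Edge : Type
  [fintypeCrossing : Fintype Crossing]
  [decEqCrossing : DecidableEq Crossing]
  [fintypeEdge : Fintype Edge]
  [decEqEdge : DecidableEq Edge]
  /-- The edge that follows a given edge along the oriented knot. -/
  next : Equiv.Perm Edge
  /-- There is exactly one component. -/
  sameCycle : ∀ e e' : Edge, next.SameCycle e e'
  /-- The edge that arrives at the crossing on the lower strand. -/
  lower : Crossing → Edge
  /-- The edge that arrives at the crossing on the upper strand. -/
  upper : Crossing → Edge
  /-- Every edge arrives at no more than one crossing, and on one strand. -/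
  injective : Function.Injective (Sum.elim lower upper)
  /-- Whether the crossing is positive; otherwise it is negative. -/
  positive : Crossing → Bool

attribute [instance] KnotDiagram.fintypeCrossing KnotDiagram.decEqCrossing
  KnotDiagram.fintypeEdge KnotDiagram.decEqEdge

namespace KnotDiagram

/-- The head of `e` is a marked point, and not a crossing. -/
def Marked (D : KnotDiagram) (e : D.Edge) : Prop := ∀ c, D.lower c ≠ e ∧ D.upper c ≠ e

/-- The edge of the upper strand to the right of the lower strand: the upper strand runs from
west to east at a positive crossing, and from east to west at a negative one. -/
def east (D : KnotDiagram) (c : D.Crossing) : D.Edge :=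
  if D.positive c then D.next (D.upper c) else D.upper c

/-- The edge of the upper strand to the left of the lower strand. -/
def west (D : KnotDiagram) (c : D.Crossing) : D.Edge :=
  if D.positive c then D.upper c else D.next (D.upper c)

/-- Adjacency of the sides of edges: `(e, true)` is the left and `(e, false)` the right side of
`e`. Two sides are adjacent if they follow each other at a marked point or if they bound the same
corner (southeast, northeast, northwest, southwest) of a crossing. -/
inductive SideAdj (D : KnotDiagram) : D.Edge × Bool → D.Edge × Bool → Prop
  | marked (e : D.Edge) (s : Bool) (h : D.Marked e) : SideAdj D (e, s) (D.next e, s)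
  | southeast (c : D.Crossing) : SideAdj D (D.lower c, false) (D.east c, !D.positive c)
  | northeast (c : D.Crossing) : SideAdj D (D.next (D.lower c), false) (D.east c, D.positive c)
  | northwest (c : D.Crossing) : SideAdj D (D.next (D.lower c), true) (D.west c, D.positive c)
  | southwest (c : D.Crossing) : SideAdj D (D.lower c, true) (D.west c, !D.positive c)

/-- The faces: the boundary components of a ribbon neighbourhood of the diagram. -/
def Face (D : KnotDiagram) : Type := Quot D.SideAdj

/-- The code is that of a diagram on the sphere. A knot projection is connected; with `n`
crossings and `m` marked points it has `n + m` vertices and `2 n + m` edges, so that Euler's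
formula says that there are `n + 2` faces. -/
def IsPlanar (D : KnotDiagram) : Prop := Nat.card D.Face = Fintype.card D.Crossing + 2

/-- A resolution of all crossings: `false` is the `0`-resolution and `true` the
`1`-resolution. -/
abbrev Resolution (D : KnotDiagram) : Type := D.Crossing → Bool

/-- Two edges are joined in the resolution `v`, at a marked point or by one of the two arcs that
replace a crossing. The `0`-resolution joins south to east and north to west, the
`1`-resolution south to west and north to east. -/
inductive Joined (D : KnotDiagram) (v : D.Resolution) : D.Edge → D.Edge → Prop
  | marked (e : D.Edge) (h : D.Marked e) : Joined D v e (D.next e)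
  | zeroSouth (c : D.Crossing) (h : v c = false) : Joined D v (D.lower c) (D.east c)
  | zeroNorth (c : D.Crossing) (h : v c = false) : Joined D v (D.next (D.lower c)) (D.west c)
  | oneSouth (c : D.Crossing) (h : v c = true) : Joined D v (D.lower c) (D.west c)
  | oneNorth (c : D.Crossing) (h : v c = true) : Joined D v (D.next (D.lower c)) (D.east c)

/-- The relation of lying on the same circle of the resolution. -/
def circleSetoid (D : KnotDiagram) (v : D.Resolution) : Setoid D.Edge :=
  Relation.EqvGen.setoid (D.Joined v)

/-- The set of circles of the resolution `v`. -/
abbrev Circle (D : KnotDiagram) (v : D.Resolution) : Type := Quotient (D.circleSetoid v)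

/-- The circle of the resolution `v` that contains the edge `e`. -/
def circle (D : KnotDiagram) (v : D.Resolution) (e : D.Edge) : D.Circle v :=
  Quotient.mk (D.circleSetoid v) e

theorem circle_eq_of_joined (D : KnotDiagram) {v : D.Resolution} {e e' : D.Edge}
    (h : D.Joined v e e') : D.circle v e = D.circle v e' :=
  Quotient.sound (Relation.EqvGen.rel _ _ h)

/-- Send each circle of `v` to a circle of `w` that shares an edge with it. If `w` arises from `v`
by a merge, this is the map from circles to circles; if it arises by a split, it sends the circle
that splits to one of the two resulting circles, and all others to themselves. -/
noncomputable def carry (D : KnotDiagram) (v w : D.Resolution) (z : D.Circle v) : D.Circle w :=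
  D.circle w z.out

open Classical in
/-- The edge map from the resolution `v` to the resolution `w` for the cobordism at the crossing
`c`, used when `w` is `v` with `c` changed from `0` to `1`. If the two arcs of `w` at `c` lie on
the same circle, then that circle is the result of a merge, and the edge map is the algebra map
induced by the map of circles. If they lie on different circles `β` and `γ`, then these are the
result of a split, and the edge map is the algebra map induced by `carry`, followed by
multiplication by `x_β + x_γ + u`. -/
noncomputable def edgeMap (D : KnotDiagram) (c : D.Crossing) (v w : D.Resolution) :
    CircleAlgebra (D.Circle v) →ₗ[BNRing] CircleAlgebra (D.Circle w) :=
  if D.circle w (D.lower c) = D.circle w (D.next (D.lower c)) then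
    (CircleAlgebra.relabel (D.carry v w)).toLinearMap
  else
    LinearMap.mulLeft BNRing
        (CircleAlgebra.x (D.circle w (D.lower c)) +
          CircleAlgebra.x (D.circle w (D.next (D.lower c))) + CircleAlgebra.u (D.Circle w)) ∘ₗ
      (CircleAlgebra.relabel (D.carry v w)).toLinearMap

/-- The underlying module of the Bar-Natan complex: the direct sum over the (finite) cube of
resolutions. -/
abbrev Chain (D : KnotDiagram) : Type := ∀ v : D.Resolution, CircleAlgebra (D.Circle v)

/-- The differential of the Bar-Natan complex: the sum of the edge maps. Its component at `w` is
the sum over the crossings `c` with `w c = 1` of the edge map from the resolution that differs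
from `w` at `c` only. -/
noncomputable def differential (D : KnotDiagram) : D.Chain →ₗ[BNRing] D.Chain :=
  LinearMap.pi fun w => ∑ c : D.Crossing,
    if w c = true then
      D.edgeMap c (Function.update w c false) w ∘ₗ LinearMap.proj (Function.update w c false)
    else 0

/-- The number of positive crossings. -/
def nPlus (D : KnotDiagram) : ℕ := (Finset.univ.filter fun c => D.positive c = true).card

/-- The number of negative crossings. -/
def nMinus (D : KnotDiagram) : ℕ := (Finset.univ.filter fun c => D.positive c = false).card

/-- The number of crossings that are `1`-resolved. -/
def weight (D : KnotDiagram) (v : D.Resolution) : ℕ :=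
  (Finset.univ.filter fun c => v c = true).card

/-- The homological grading of the generators at `v`. -/
def grH (D : KnotDiagram) (v : D.Resolution) : ℤ := (D.weight v : ℤ) - D.nMinus

/-- The quantum grading of the generator at `v` in which the circles of `S` are labelled `x`. -/
noncomputable def grQ (D : KnotDiagram) (v : D.Resolution) (S : Finset (D.Circle v)) : ℤ :=
  (Nat.card (D.Circle v) : ℤ) - 2 * S.card + D.weight v + D.nPlus - 2 * D.nMinus

/-- The homogeneous elements of bigrading `(i, j)`, where `u` has bigrading `(0, -2)`. -/
noncomputable def homogeneous (D : KnotDiagram) (i j : ℤ) : AddSubgroup D.Chain :=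
  AddSubgroup.closure {a | ∃ (v : D.Resolution) (S : Finset (D.Circle v)) (k : ℕ),
    D.grH v = i ∧ D.grQ v S - 2 * k = j ∧
      a = Pi.single v (BNRing.u ^ k • CircleAlgebra.gen S)}

/-- The unpointed reduced complex, as a submodule. -/
noncomputable def unpointedReduced (D : KnotDiagram) : Submodule BNRing D.Chain :=
  Submodule.pi Set.univ fun v => Subalgebra.toSubmodule (CircleAlgebra.unpointed (D.Circle v))

/-- The pointed reduced complex for a basepoint on the edge `e`, as a submodule. -/
noncomputable def pointedReduced (D : KnotDiagram) (e : D.Edge) : Submodule BNRing D.Chain :=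
  Submodule.pi Set.univ fun v => CircleAlgebra.pointed (D.circle v e)

theorem edgeMap_mem_unpointed (D : KnotDiagram) (c : D.Crossing) (v w : D.Resolution)
    {a : CircleAlgebra (D.Circle v)} (ha : a ∈ CircleAlgebra.unpointed (D.Circle v)) :
    D.edgeMap c v w a ∈ CircleAlgebra.unpointed (D.Circle w) := by
  have h := CircleAlgebra.relabel_mem_unpointed (D.carry v w) ha
  unfold edgeMap
  split_ifs
  · exact h
  · exact Subalgebra.mul_mem _ (Subalgebra.add_mem _ (CircleAlgebra.add_mem_unpointed _ _)
      (Subalgebra.algebraMap_mem _ _)) h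

theorem differential_mem_unpointedReduced (D : KnotDiagram) :
    ∀ a ∈ D.unpointedReduced, D.differential a ∈ D.unpointedReduced := by
  intro a ha w _
  rw [differential, LinearMap.pi_apply, LinearMap.sum_apply]
  refine Submodule.sum_mem _ fun c _ => ?_
  split_ifs
  · exact D.edgeMap_mem_unpointed c _ w (ha _ (Set.mem_univ _))
  · exact Submodule.zero_mem _

/-- Two edges on the same circle before the crossing `c` is changed from `0` to `1` are afterwards
on the same circle, or on the circles that pass through `c`. -/
theorem circle_update (D : KnotDiagram) (c : D.Crossing) (w : D.Resolution) (hw : w c = true)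
    {e e' : D.Edge} (h : D.circle (Function.update w c false) e =
      D.circle (Function.update w c false) e') :
    D.circle w e = D.circle w e' ∨
      (D.circle w e = D.circle w (D.lower c) ∨ D.circle w e = D.circle w (D.next (D.lower c))) ∧
      (D.circle w e' = D.circle w (D.lower c) ∨
        D.circle w e' = D.circle w (D.next (D.lower c))) := by
  have hS : D.circle w (D.lower c) = D.circle w (D.west c) :=
    D.circle_eq_of_joined (.oneSouth c hw)
  have hN : D.circle w (D.next (D.lower c)) = D.circle w (D.east c) :=
    D.circle_eq_of_joined (.oneNorth c hw)
  have h' : Relation.EqvGen (D.Joined (Function.update w c false)) e e' := Quotient.exact h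
  clear h
  induction h' with
  | rel a b hab =>
    cases hab with
    | marked _ hm => exact Or.inl (D.circle_eq_of_joined (.marked _ hm))
    | zeroSouth d hd =>
      by_cases hdc : d = c
      · subst hdc
        exact Or.inr ⟨Or.inl rfl, Or.inr hN.symm⟩
      · rw [Function.update_of_ne hdc] at hd
        exact Or.inl (D.circle_eq_of_joined (.zeroSouth d hd))
    | zeroNorth d hd =>
      by_cases hdc : d = c
      · subst hdc
        exact Or.inr ⟨Or.inr rfl, Or.inl hS.symm⟩
      · rw [Function.update_of_ne hdc] at hd
        exact Or.inl (D.circle_eq_of_joined (.zeroNorth d hd))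
    | oneSouth d hd =>
      by_cases hdc : d = c
      · subst hdc
        simp at hd
      · rw [Function.update_of_ne hdc] at hd
        exact Or.inl (D.circle_eq_of_joined (.oneSouth d hd))
    | oneNorth d hd =>
      by_cases hdc : d = c
      · subst hdc
        simp at hd
      · rw [Function.update_of_ne hdc] at hd
        exact Or.inl (D.circle_eq_of_joined (.oneNorth d hd))
  | refl a => exact Or.inl rfl
  | symm a b _ ih =>
    rcases ih with ih | ⟨h1, h2⟩
    · exact Or.inl ih.symm
    · exact Or.inr ⟨h2, h1⟩
  | trans a b d _ _ ih1 ih2 =>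
    rcases ih1 with ih1 | ⟨h1, h2⟩
    · rw [ih1]
      exact ih2
    · rcases ih2 with ih2 | ⟨k1, k2⟩
      · rw [ih2] at h2
        exact Or.inr ⟨h1, h2⟩
      · exact Or.inr ⟨h1, k2⟩

theorem edgeMap_mem_pointed (D : KnotDiagram) (c : D.Crossing) (w : D.Resolution)
    (hw : w c = true) (p : D.Edge) {a : CircleAlgebra (D.Circle (Function.update w c false))}
    (ha : a ∈ CircleAlgebra.pointed (D.circle (Function.update w c false) p)) :
    D.edgeMap c (Function.update w c false) w a ∈ CircleAlgebra.pointed (D.circle w p) := by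
  obtain ⟨b, rfl⟩ := CircleAlgebra.mem_pointed.1 ha
  have hout : D.circle (Function.update w c false)
      (D.circle (Function.update w c false) p).out =
        D.circle (Function.update w c false) p := Quotient.out_eq _
  have key := D.circle_update c w hw hout
  have hcarry : D.carry (Function.update w c false) w
      (D.circle (Function.update w c false) p) =
        D.circle w (D.circle (Function.update w c false) p).out := rfl
  unfold edgeMap
  split_ifs with hm
  · rw [AlgHom.toLinearMap_apply, map_mul, CircleAlgebra.relabel_x, hcarry]
    have hsame : D.circle w (D.circle (Function.update w c false) p).out = D.circle w p := by
      rw [← hm, or_self, or_self] at key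
      rcases key with key | ⟨h2, h3⟩
      · exact key
      · rw [h2, h3]
    rw [hsame]
    exact CircleAlgebra.mem_pointed.2 ⟨_, rfl⟩
  · rw [LinearMap.comp_apply, AlgHom.toLinearMap_apply, map_mul, CircleAlgebra.relabel_x, hcarry,
      LinearMap.mulLeft_apply, ← mul_assoc]
    have hs := CircleAlgebra.split_mul (D.circle w (D.lower c))
      (D.circle w (D.next (D.lower c)))
    have hsame : (CircleAlgebra.x (D.circle w (D.lower c)) +
          CircleAlgebra.x (D.circle w (D.next (D.lower c))) + CircleAlgebra.u (D.Circle w)) *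
          CircleAlgebra.x (D.circle w (D.circle (Function.update w c false) p).out) =
        CircleAlgebra.x (D.circle w p) * (CircleAlgebra.x (D.circle w (D.lower c)) +
          CircleAlgebra.x (D.circle w (D.next (D.lower c))) + CircleAlgebra.u (D.Circle w)) := by
      rw [mul_comm (CircleAlgebra.x (D.circle w p))]
      rcases key with key | ⟨h2, h3⟩
      · rw [key]
      · rcases h2 with h2 | h2 <;> rcases h3 with h3 | h3 <;> rw [h2, h3]
        · exact hs
        · exact hs.symm
    rw [hsame, mul_assoc]
    exact CircleAlgebra.mem_pointed.2 ⟨_, rfl⟩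

theorem differential_mem_pointedReduced (D : KnotDiagram) (p : D.Edge) :
    ∀ a ∈ D.pointedReduced p, D.differential a ∈ D.pointedReduced p := by
  intro a ha w _
  rw [differential, LinearMap.pi_apply, LinearMap.sum_apply]
  refine Submodule.sum_mem _ fun c _ => ?_
  split_ifs with hw
  · exact D.edgeMap_mem_pointed c w hw p (ha _ (Set.mem_univ _))
  · exact Submodule.zero_mem _

end KnotDiagram

/-! ### Bigraded complexes with an involution -/

/-- The data of a bigraded complex over `𝔽[u]` with an involution. -/
structure InvolutiveComplex where
  /-- The underlying module. -/
  carrier : Type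
  [addCommGroup : AddCommGroup carrier]
  [module : Module BNRing carrier]
  /-- The differential. -/
  d : carrier →ₗ[BNRing] carrier
  /-- The involution. -/
  tau : carrier →ₗ[BNRing] carrier
  /-- The homogeneous elements of bigrading `(i, j)`. -/
  homogeneous : ℤ → ℤ → AddSubgroup carrier

attribute [instance] InvolutiveComplex.addCommGroup InvolutiveComplex.module

namespace InvolutiveComplex

/-- The tensor product over `𝔽[u]`, with the diagonal involution. -/
noncomputable def tensor (A B : InvolutiveComplex) : InvolutiveComplex where
  carrier := A.carrier ⊗[BNRing] B.carrier
  d := TensorProduct.map A.d LinearMap.id + TensorProduct.map LinearMap.id B.d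
  tau := TensorProduct.map A.tau B.tau
  homogeneous i j := AddSubgroup.closure {t | ∃ (i₁ i₂ j₁ j₂ : ℤ) (a : A.carrier) (b : B.carrier),
    i₁ + i₂ = i ∧ j₁ + j₂ = j ∧ a ∈ A.homogeneous i₁ j₁ ∧ b ∈ B.homogeneous i₂ j₂ ∧
      t = a ⊗ₜ[BNRing] b}

/-- An equivariant isomorphism: an isomorphism of bigraded complexes over `𝔽[u]` that commutes
with the involutions. -/
structure EquivariantIso (A B : InvolutiveComplex) where
  /-- The underlying isomorphism of modules. -/
  toLinearEquiv : A.carrier ≃ₗ[BNRing] B.carrier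
  map_d : ∀ a, toLinearEquiv (A.d a) = B.d (toLinearEquiv a)
  map_tau : ∀ a, toLinearEquiv (A.tau a) = B.tau (toLinearEquiv a)
  map_homogeneous : ∀ i j a, toLinearEquiv a ∈ B.homogeneous i j ↔ a ∈ A.homogeneous i j

end InvolutiveComplex

/-! ### Transvergent diagrams of strongly invertible knots -/

/-- A diagram with the symmetry of a transvergent diagram of a strongly invertible knot: the
rotation by `π` about an axis in the plane of projection reflects the plane and exchanges upper and
lower strands, and it reverses the orientation of the knot. The two points of the knot on the axis
are among the marked points, so that no edge is mapped to itself. -/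
structure TransvergentDiagram extends KnotDiagram where
  /-- The action on crossings. -/
  tauC : Crossing → Crossing
  /-- The action on edges. -/
  tauE : Edge → Edge
  tauC_tauC : ∀ c, tauC (tauC c) = c
  tauE_tauE : ∀ e, tauE (tauE e) = e
  tauE_ne : ∀ e, tauE e ≠ e
  next_tauE_next : ∀ e, next (tauE (next e)) = tauE e
  lower_tauC : ∀ c, lower (tauC c) = tauE (next (upper c))
  upper_tauC : ∀ c, upper (tauC c) = tauE (next (lower c))
  positive_tauC : ∀ c, positive (tauC c) = positive c

namespace TransvergentDiagram

/-- The points of the knot on the axis, that is, the possible equivariant basepoints. Such a point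
is given by the edge that arrives there; the involution maps this edge to the following one. -/
def FixedPoint (D : TransvergentDiagram) : Type := {e : D.Edge // D.tauE e = D.next e}

theorem next_tauE (D : TransvergentDiagram) (e : D.Edge) :
    D.next (D.tauE e) = D.tauE (D.next.symm e) := by
  have h := D.next_tauE_next (D.next.symm e)
  rwa [Equiv.apply_symm_apply] at h

theorem marked_tauE (D : TransvergentDiagram) {e : D.Edge} (h : D.Marked e) :
    D.Marked (D.next.symm (D.tauE e)) := by
  intro c
  constructor
  · intro hc
    apply (h (D.tauC c)).2
    rw [D.upper_tauC, hc, Equiv.apply_symm_apply, D.tauE_tauE]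
  · intro hc
    apply (h (D.tauC c)).1
    rw [D.lower_tauC, hc, Equiv.apply_symm_apply, D.tauE_tauE]

theorem marked_fixedPoint (D : TransvergentDiagram) (p : D.FixedPoint) : D.Marked p.1 := by
  have key : ∀ c, D.lower c = p.1 → D.upper (D.tauC c) = p.1 := by
    intro c hc
    rw [D.upper_tauC, hc, ← p.2, D.tauE_tauE]
  have key' : ∀ c, D.upper c = p.1 → D.lower (D.tauC c) = p.1 := by
    intro c hc
    rw [D.lower_tauC, hc, ← p.2, D.tauE_tauE]
  intro c
  constructor
  · intro hc
    have h := @D.injective (Sum.inl c) (Sum.inr (D.tauC c)) (by simp [hc, key c hc])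
    cases h
  · intro hc
    have h := @D.injective (Sum.inr c) (Sum.inl (D.tauC c)) (by simp [hc, key' c hc])
    cases h

/-- The action of the involution on resolutions. -/
def tauR (D : TransvergentDiagram) (v : D.Resolution) : D.Resolution := fun c => v (D.tauC c)

theorem tauE_joined (D : TransvergentDiagram) (w : D.Resolution) {e e' : D.Edge}
    (h : D.Joined (D.tauR w) e e') :
    D.circle w (D.tauE e) = D.circle w (D.tauE e') := by
  cases h with
  | marked _ h =>
    have hj := D.circle_eq_of_joined (KnotDiagram.Joined.marked (v := w) _ (D.marked_tauE h))
    rw [Equiv.apply_symm_apply] at hj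
    have h2 : D.tauE (D.next e) = D.next.symm (D.tauE e) := by
      rw [Equiv.eq_symm_apply, D.next_tauE_next]
    rw [h2, hj]
  | zeroSouth c h =>
    have h0 : w (D.tauC c) = false := h
    have hS := D.circle_eq_of_joined (.zeroSouth _ h0)
    have hN := D.circle_eq_of_joined (.zeroNorth _ h0)
    simp only [KnotDiagram.east, KnotDiagram.west, D.lower_tauC, D.upper_tauC, D.positive_tauC,
      D.next_tauE_next] at hS hN ⊢
    by_cases hp : D.positive c = true
    · simp only [hp, if_true] at hS hN ⊢
      exact hS.symm
    · simp only [hp] at hS hN ⊢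
      exact hN.symm
  | zeroNorth c h =>
    have h0 : w (D.tauC c) = false := h
    have hS := D.circle_eq_of_joined (.zeroSouth _ h0)
    have hN := D.circle_eq_of_joined (.zeroNorth _ h0)
    simp only [KnotDiagram.east, KnotDiagram.west, D.lower_tauC, D.upper_tauC, D.positive_tauC,
      D.next_tauE_next] at hS hN ⊢
    by_cases hp : D.positive c = true
    · simp only [hp, if_true] at hS hN ⊢
      exact hN.symm
    · simp only [hp] at hS hN ⊢
      exact hS.symm
  | oneSouth c h =>
    have h0 : w (D.tauC c) = true := h
    have hS := D.circle_eq_of_joined (.oneSouth _ h0)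
    have hN := D.circle_eq_of_joined (.oneNorth _ h0)
    simp only [KnotDiagram.east, KnotDiagram.west, D.lower_tauC, D.upper_tauC, D.positive_tauC,
      D.next_tauE_next] at hS hN ⊢
    by_cases hp : D.positive c = true
    · simp only [hp, if_true] at hS hN ⊢
      exact hN.symm
    · simp only [hp] at hS hN ⊢
      exact hS.symm
  | oneNorth c h =>
    have h0 : w (D.tauC c) = true := h
    have hS := D.circle_eq_of_joined (.oneSouth _ h0)
    have hN := D.circle_eq_of_joined (.oneNorth _ h0)
    simp only [KnotDiagram.east, KnotDiagram.west, D.lower_tauC, D.upper_tauC, D.positive_tauC,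
      D.next_tauE_next] at hS hN ⊢
    by_cases hp : D.positive c = true
    · simp only [hp, if_true] at hS hN ⊢
      exact hS.symm
    · simp only [hp] at hS hN ⊢
      exact hN.symm

theorem tauE_eqvGen (D : TransvergentDiagram) (w : D.Resolution) {e e' : D.Edge}
    (h : Relation.EqvGen (D.Joined (D.tauR w)) e e') :
    D.circle w (D.tauE e) = D.circle w (D.tauE e') := by
  induction h with
  | rel a b hab => exact D.tauE_joined w hab
  | refl a => rfl
  | symm a b _ ih => exact ih.symm
  | trans a b c _ _ ih1 ih2 => exact ih1.trans ih2

/-- The action of the involution on circles, from the resolution `τ w` to `w = τ (τ w)`. -/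
def tauCircle (D : TransvergentDiagram) (w : D.Resolution) :
    D.Circle (D.tauR w) → D.Circle w :=
  Quotient.lift (fun e => D.circle w (D.tauE e)) fun _ _ h => D.tauE_eqvGen w h

/-- The action of the involution on the Bar-Natan complex. -/
noncomputable def tau (D : TransvergentDiagram) : D.Chain →ₗ[BNRing] D.Chain :=
  LinearMap.pi fun w =>
    (CircleAlgebra.relabel (D.tauCircle w)).toLinearMap ∘ₗ LinearMap.proj (D.tauR w)

theorem tau_mem_unpointedReduced (D : TransvergentDiagram) :
    ∀ a ∈ D.unpointedReduced, D.tau a ∈ D.unpointedReduced := by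
  intro a ha w _
  exact CircleAlgebra.relabel_mem_unpointed _ (ha (D.tauR w) (Set.mem_univ _))

theorem tau_mem_pointedReduced (D : TransvergentDiagram) (p : D.FixedPoint) :
    ∀ a ∈ D.pointedReduced p.1, D.tau a ∈ D.pointedReduced p.1 := by
  intro a ha w _
  obtain ⟨b, hb⟩ := CircleAlgebra.mem_pointed.1 (ha (D.tauR w) (Set.mem_univ _))
  have hp : D.tauCircle w (D.circle (D.tauR w) p.1) = D.circle w p.1 := by
    have h1 : D.tauCircle w (D.circle (D.tauR w) p.1) = D.circle w (D.tauE p.1) := rfl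
    rw [h1, p.2]
    exact (D.circle_eq_of_joined (.marked _ (D.marked_fixedPoint p))).symm
  have h2 : D.tau a w = CircleAlgebra.relabel (D.tauCircle w) (a (D.tauR w)) := rfl
  rw [h2, ← hb, map_mul, CircleAlgebra.relabel_x, hp]
  exact CircleAlgebra.mem_pointed.2 ⟨_, rfl⟩

/-- The available constructions of the reduced complex: the unpointed one, and the pointed one for
each equivariant basepoint. -/
inductive ReducedModel (D : TransvergentDiagram) : Type
  | unpointed : ReducedModel D
  | pointed (p : D.FixedPoint) : ReducedModel D

/-- The reduced Bar-Natan complex with its involution. The quantum grading is shifted by `-1` in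
the unpointed and by `1` in the pointed construction, so that for the crossingless unknot the
generator lies in bigrading `(0, 0)`. -/
noncomputable def reduced (D : TransvergentDiagram) : D.ReducedModel → InvolutiveComplex
  | .unpointed =>
    { carrier := D.unpointedReduced
      d := D.differential.restrict D.differential_mem_unpointedReduced
      tau := D.tau.restrict D.tau_mem_unpointedReduced
      homogeneous := fun i j =>
        (D.homogeneous i (j + 1)).comap D.unpointedReduced.subtype.toAddMonoidHom }
  | .pointed p =>
    { carrier := D.pointedReduced p.1
      d := D.differential.restrict (D.differential_mem_pointedReduced p.1)
      tau := D.tau.restrict (D.tau_mem_pointedReduced p)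
      homogeneous := fun i j =>
        (D.homogeneous i (j - 1)).comap (D.pointedReduced p.1).subtype.toAddMonoidHom }

/-! ### Equivariant connected sums -/

/-- The diagram with the orientation of the knot reversed. -/
def reverse (D : TransvergentDiagram) : TransvergentDiagram where
  Crossing := D.Crossing
  Edge := D.Edge
  next := D.next.symm
  sameCycle e e' := (D.sameCycle e e').inv
  lower c := D.next (D.lower c)
  upper c := D.next (D.upper c)
  injective := by
    have h : Sum.elim (fun c => D.next (D.lower c)) (fun c => D.next (D.upper c)) =
        D.next ∘ Sum.elim D.lower D.upper := by
      funext c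
      cases c <;> rfl
    rw [h]
    exact D.next.injective.comp D.injective
  positive := D.positive
  tauC := D.tauC
  tauE := D.tauE
  tauC_tauC := D.tauC_tauC
  tauE_tauE := D.tauE_tauE
  tauE_ne := D.tauE_ne
  next_tauE_next e := by
    rw [Equiv.symm_apply_eq, D.next_tauE]
  lower_tauC c := by
    rw [D.lower_tauC, Equiv.symm_apply_apply, D.next_tauE_next]
  upper_tauC c := by
    rw [D.upper_tauC, Equiv.symm_apply_apply, D.next_tauE_next]
  positive_tauC := D.positive_tauC

/-- A point on the axis, as a point of the reversed knot. -/
def FixedPoint.reverse {D : TransvergentDiagram} (p : D.FixedPoint) : D.reverse.FixedPoint :=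
  ⟨D.next p.1, by
    change D.tauE (D.next p.1) = D.next.symm (D.next p.1)
    rw [Equiv.symm_apply_apply, ← p.2, D.tauE_tauE]⟩

/-- The permutation that follows `f` and `g`, but jumps from `a` to `g b` and from `b`
to `f a`. -/
def splice {α β : Type} [DecidableEq α] [DecidableEq β] (f : Equiv.Perm α) (g : Equiv.Perm β)
    (a : α) (b : β) : Equiv.Perm (α ⊕ β) :=
  Equiv.sumCongr f g * Equiv.swap (Sum.inl a) (Sum.inr b)

section splice

variable {α β : Type} [DecidableEq α] [DecidableEq β] (f : Equiv.Perm α) (g : Equiv.Perm β)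
  (a : α) (b : β)

theorem splice_inl : splice f g a b (Sum.inl a) = Sum.inr (g b) := by
  simp [splice]

theorem splice_inr : splice f g a b (Sum.inr b) = Sum.inl (f a) := by
  simp [splice]

theorem splice_inl_of_ne {c : α} (h : c ≠ a) :
    splice f g a b (Sum.inl c) = Sum.inl (f c) := by
  simp [splice, Equiv.swap_apply_of_ne_of_ne, h]

theorem splice_inr_of_ne {c : β} (h : c ≠ b) :
    splice f g a b (Sum.inr c) = Sum.inr (g c) := by
  simp [splice, Equiv.swap_apply_of_ne_of_ne, h]

theorem splice_sameCycle [Finite α] [Finite β] (hf : ∀ c c', f.SameCycle c c')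
    (hg : ∀ c c', g.SameCycle c c') (s t : α ⊕ β) : (splice f g a b).SameCycle s t := by
  have step : ∀ s, (splice f g a b).SameCycle s (splice f g a b s) := fun s => ⟨1, by simp⟩
  have hl : ∀ n : ℕ, (splice f g a b).SameCycle (Sum.inl (f a)) (Sum.inl ((f ^ n) (f a))) := by
    intro n
    induction n with
    | zero => exact Equiv.Perm.SameCycle.refl _ _
    | succ n ih =>
      rw [pow_succ', Equiv.Perm.mul_apply]
      by_cases h : (f ^ n) (f a) = a
      · rw [h]
      · have := step (Sum.inl ((f ^ n) (f a)))
        rw [splice_inl_of_ne f g a b h] at this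
        exact ih.trans this
  have hr : ∀ n : ℕ, (splice f g a b).SameCycle (Sum.inr (g b)) (Sum.inr ((g ^ n) (g b))) := by
    intro n
    induction n with
    | zero => exact Equiv.Perm.SameCycle.refl _ _
    | succ n ih =>
      rw [pow_succ', Equiv.Perm.mul_apply]
      by_cases h : (g ^ n) (g b) = b
      · rw [h]
      · have := step (Sum.inr ((g ^ n) (g b)))
        rw [splice_inr_of_ne f g a b h] at this
        exact ih.trans this
  have hl' : ∀ c, (splice f g a b).SameCycle (Sum.inl (f a)) (Sum.inl c) := by
    intro c
    obtain ⟨n, hn⟩ := (hf (f a) c).exists_nat_pow_eq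
    rw [← hn]
    exact hl n
  have hr' : ∀ c, (splice f g a b).SameCycle (Sum.inr (g b)) (Sum.inr c) := by
    intro c
    obtain ⟨n, hn⟩ := (hg (g b) c).exists_nat_pow_eq
    rw [← hn]
    exact hr n
  have hlr : (splice f g a b).SameCycle (Sum.inl (f a)) (Sum.inr (g b)) := by
    have := step (Sum.inl a)
    rw [splice_inl] at this
    exact (hl' a).trans this
  have all : ∀ s, (splice f g a b).SameCycle (Sum.inl (f a)) s := by
    rintro (c | c)
    · exact hl' c
    · exact hlr.trans (hr' c)
  exact (all s).symm.trans (all t)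

end splice

/-- The equivariant connected sum along fixed points `p₁` and `p₂` that respects the given
orientations: both diagrams are cut at these points, the edge that arrives at `p₁` is joined to
the one that leaves `p₂`, and the edge that arrives at `p₂` is joined to the one that
leaves `p₁`. -/
def orientedSum (D₁ : TransvergentDiagram) (p₁ : D₁.FixedPoint) (D₂ : TransvergentDiagram)
    (p₂ : D₂.FixedPoint) : TransvergentDiagram where
  Crossing := D₁.Crossing ⊕ D₂.Crossing
  Edge := D₁.Edge ⊕ D₂.Edge
  next := splice D₁.next D₂.next p₁.1 p₂.1
  sameCycle := splice_sameCycle _ _ _ _ D₁.sameCycle D₂.sameCycle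
  lower := Sum.map D₁.lower D₂.lower
  upper := Sum.map D₁.upper D₂.upper
  injective := by
    have h₁ := D₁.injective
    have h₂ := D₂.injective
    rintro ((a | a) | (a | a)) ((b | b) | (b | b)) h <;>
      simp only [Sum.elim_inl, Sum.elim_inr, Sum.map_inl, Sum.map_inr, reduceCtorEq,
        Sum.inl.injEq, Sum.inr.injEq] at h
    · have := @h₁ (.inl a) (.inl b) h
      simpa using this
    · have := @h₁ (.inl a) (.inr b) h
      simp at this
    · have := @h₂ (.inl a) (.inl b) h
      simpa using this
    · have := @h₂ (.inl a) (.inr b) h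
      simp at this
    · have := @h₁ (.inr a) (.inl b) h
      simp at this
    · have := @h₁ (.inr a) (.inr b) h
      simpa using this
    · have := @h₂ (.inr a) (.inl b) h
      simp at this
    · have := @h₂ (.inr a) (.inr b) h
      simpa using this
  positive := Sum.elim D₁.positive D₂.positive
  tauC := Sum.map D₁.tauC D₂.tauC
  tauE := Sum.map D₁.tauE D₂.tauE
  tauC_tauC := by
    rintro (c | c)
    · simp [D₁.tauC_tauC]
    · simp [D₂.tauC_tauC]
  tauE_tauE := by
    rintro (c | c)
    · simp [D₁.tauE_tauE]
    · simp [D₂.tauE_tauE]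
  tauE_ne := by
    rintro (c | c)
    · simp [D₁.tauE_ne]
    · simp [D₂.tauE_ne]
  next_tauE_next := by
    rintro (e | e)
    · by_cases h : e = p₁.1
      · subst h
        rw [splice_inl, Sum.map_inr, ← p₂.2, D₂.tauE_tauE, splice_inr, Sum.map_inl, p₁.2]
      · have h' : D₁.tauE (D₁.next e) ≠ p₁.1 := by
          intro h2
          apply h
          apply D₁.next.injective
          rw [← D₁.tauE_tauE (D₁.next e), h2, p₁.2]
        rw [splice_inl_of_ne _ _ _ _ h, Sum.map_inl, splice_inl_of_ne _ _ _ _ h', Sum.map_inl,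
          D₁.next_tauE_next]
    · by_cases h : e = p₂.1
      · subst h
        rw [splice_inr, Sum.map_inl, ← p₁.2, D₁.tauE_tauE, splice_inl, Sum.map_inr, p₂.2]
      · have h' : D₂.tauE (D₂.next e) ≠ p₂.1 := by
          intro h2
          apply h
          apply D₂.next.injective
          rw [← D₂.tauE_tauE (D₂.next e), h2, p₂.2]
        rw [splice_inr_of_ne _ _ _ _ h, Sum.map_inr, splice_inr_of_ne _ _ _ _ h', Sum.map_inr,
          D₂.next_tauE_next]
  lower_tauC := by
    rintro (c | c)
    · have h := (D₁.marked_fixedPoint p₁ c).2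
      simp only [Sum.map_inl]
      rw [splice_inl_of_ne _ _ _ _ h, Sum.map_inl, D₁.lower_tauC]
    · have h := (D₂.marked_fixedPoint p₂ c).2
      simp only [Sum.map_inr]
      rw [splice_inr_of_ne _ _ _ _ h, Sum.map_inr, D₂.lower_tauC]
  upper_tauC := by
    rintro (c | c)
    · have h := (D₁.marked_fixedPoint p₁ c).1
      simp only [Sum.map_inl]
      rw [splice_inl_of_ne _ _ _ _ h, Sum.map_inl, D₁.upper_tauC]
    · have h := (D₂.marked_fixedPoint p₂ c).1
      simp only [Sum.map_inr]
      rw [splice_inr_of_ne _ _ _ _ h, Sum.map_inr, D₂.upper_tauC]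
  positive_tauC := by
    rintro (c | c)
    · exact D₁.positive_tauC c
    · exact D₂.positive_tauC c

/-- The equivariant connected sums along fixed points `p₁` and `p₂`. There are two equivariant ways
to join the four loose ends; the second one amounts to a rotation of the second diagram by `π`
in the plane, and it respects the orientations after that of the second knot is reversed. -/
def connectedSum (D₁ : TransvergentDiagram) (p₁ : D₁.FixedPoint) (D₂ : TransvergentDiagram)
    (p₂ : D₂.FixedPoint) (rotated : Bool) : TransvergentDiagram :=
  match rotated with
  | false => orientedSum D₁ p₁ D₂ p₂
  | true => orientedSum D₁ p₁ D₂.reverse p₂.reverse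

end TransvergentDiagram

/-!
Choose a circle `p` in a collection `Z` of circles, and let `A` be the circle algebra of `Z` and `U`
its unpointed subalgebra. Since `x_c = x_p + (x_c + x_p)`, the algebra `A` is generated by `x_p`
over `U`, and multiplication by `x_p` is an isomorphism from `U` to the pointed submodule `x_p A`.
It commutes with the edge maps and, if `p` is the circle through a point on the axis, with the
involution. As it lowers the quantum grading by `2`, the pointed and the unpointed reduced complexes
agree (`unpointedIsoPointed`). To see that its inverse is homogeneous as well, one extends it to a
homogeneous linear map on all of `A`: the coefficient of `ω` in the algebra map `x_c ↦ x_c + ω` to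
`A[ω]`, where `ω ^ 2 = u ω` (`contract`).

It thus suffices to treat the unpointed complexes. A circle that is cut open at one point remains
connected (`eq_next_of_cut`), so that the circles of a resolution of the connected sum are those of
the two diagrams, with the circles through the two basepoints glued together (`circleDesc`). Hence
the product `a ⊗ b ↦ a b` is an isomorphism from `U₁ ⊗ U₂` to the unpointed subalgebra of the
connected sum: an inverse is induced by `x_c ↦ (x_c + x_{c_{p₁}}) ⊗ 1` and
`x_c ↦ 1 ⊗ (x_c + x_{c_{p₂}})`, which are both zero on the glued circle (`cutCircles`). No basis of
`U` is needed. The product satisfies the Leibniz rule (`differential_mulChain`), commutes with the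
involutions (`mulChain_tau`), and is compatible with the gradings because the connected sum has one
circle less than the two diagrams together (`grOne_orientedSum`).

The second way to join the ends is the oriented sum with the reverse of the second diagram, and
reversal of the orientation changes neither the circles nor the edge maps (`reverseIso`).
-/

/-! ### Algebra maps out of a circle algebra -/

namespace CircleAlgebra

/-- The universal property of the circle algebra. -/
noncomputable def lift {Z B : Type} [CommRing B] [Algebra BNRing B] (f : Z → B)
    (hf : ∀ c, f c * f c = algebraMap BNRing B BNRing.u * f c) : CircleAlgebra Z →ₐ[BNRing] B :=
  Ideal.Quotient.liftₐ (circleIdeal Z) (MvPolynomial.aeval f) (by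
    intro a ha
    have hle : circleIdeal Z ≤ RingHom.ker (MvPolynomial.aeval (R := BNRing) f) := by
      refine Ideal.span_le.2 ?_
      rintro _ ⟨c, rfl⟩
      simp only [SetLike.mem_coe, RingHom.mem_ker, map_sub, map_pow, map_mul,
        MvPolynomial.aeval_X, MvPolynomial.aeval_C]
      rw [sq, hf, sub_self]
    exact hle ha)

@[simp] theorem lift_x {Z B : Type} [CommRing B] [Algebra BNRing B] (f : Z → B)
    (hf : ∀ c, f c * f c = algebraMap BNRing B BNRing.u * f c) (c : Z) :
    lift f hf (x c) = f c := by
  have h : lift f hf (x c) = MvPolynomial.aeval (R := BNRing) f (MvPolynomial.X c) := rfl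
  rw [h, MvPolynomial.aeval_X]

theorem induction_on {Z : Type} {P : CircleAlgebra Z → Prop} (a : CircleAlgebra Z)
    (hC : ∀ r : BNRing, P (algebraMap BNRing _ r)) (hadd : ∀ a b, P a → P b → P (a + b))
    (hmul : ∀ a c, P a → P (a * x c)) : P a := by
  obtain ⟨q, rfl⟩ := Ideal.Quotient.mk_surjective a
  induction q using MvPolynomial.induction_on with
  | C r => exact hC r
  | add p q hp hq => rw [map_add]; exact hadd _ _ hp hq
  | mul_X p c hp => rw [map_mul]; exact hmul _ _ hp

/-- Algebra maps that agree on the generators after multiplication by `t` agree everywhere after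
multiplication by `t`. For `t = x_β + x_γ + u` this says that the edge map of a split does not
depend on the choice of one of the two resulting circles. -/
theorem mul_map_eq {Z B : Type} [CommRing B] [Algebra BNRing B] (f g : CircleAlgebra Z →ₐ[BNRing] B)
    (t : B) (h : ∀ c, t * f (x c) = t * g (x c)) (a : CircleAlgebra Z) : t * f a = t * g a := by
  induction a using induction_on with
  | hC r => rw [AlgHom.commutes, AlgHom.commutes]
  | hadd a b ha hb => rw [map_add, map_add, mul_add, mul_add, ha, hb]
  | hmul a c ha =>
    rw [map_mul, map_mul, ← mul_assoc, ha, mul_right_comm, h]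
    ring

theorem hom_ext {Z B : Type} [CommRing B] [Algebra BNRing B] {f g : CircleAlgebra Z →ₐ[BNRing] B}
    (h : ∀ c, f (x c) = g (x c)) : f = g :=
  AlgHom.ext fun a => by
    simpa using mul_map_eq f g 1 (fun c => by rw [h]) a

theorem relabel_relabel {Z Z' Z'' : Type} (f : Z → Z') (g : Z' → Z'') (a : CircleAlgebra Z) :
    relabel g (relabel f a) = relabel (g ∘ f) a := by
  have h : (relabel g).comp (relabel f) = relabel (g ∘ f) := hom_ext fun c => by simp
  exact DFunLike.congr_fun h a

theorem relabel_id {Z : Type} (a : CircleAlgebra Z) : relabel id a = a := by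
  have h : relabel id = AlgHom.id BNRing (CircleAlgebra Z) := hom_ext fun c => by simp
  exact DFunLike.congr_fun h a

/-- In characteristic two, `(x_c + x_p) ^ 2 = u (x_c + x_p)`. -/
theorem add_mul_add {Z : Type} (c p : Z) : (x c + x p) * (x c + x p) = u Z * (x c + x p) := by
  have h1 := x_sq c
  have h2 := x_sq p
  have h3 := two_mul_eq_zero (x c * x p)
  linear_combination h1 + h2 + h3

theorem eqOn_unpointed {Z B : Type} [CommRing B] [Algebra BNRing B]
    {f g : CircleAlgebra Z →ₐ[BNRing] B}
    (h : ∀ c c', f (x c + x c') = g (x c + x c')) {a : CircleAlgebra Z} (ha : a ∈ unpointed Z) :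
    f a = g a := by
  have hle : unpointed Z ≤ AlgHom.equalizer f g := by
    refine Algebra.adjoin_le ?_
    rintro _ ⟨c, rfl⟩
    exact h c.1 c.2
  exact hle ha

theorem mem_unpointed_of_generators {Z Z' : Type} {f : CircleAlgebra Z →ₐ[BNRing] CircleAlgebra Z'}
    (h : ∀ c, f (x c) ∈ unpointed Z') (a : CircleAlgebra Z) : f a ∈ unpointed Z' := by
  induction a using induction_on with
  | hC r => rw [AlgHom.commutes]; exact Subalgebra.algebraMap_mem _ _
  | hadd a b ha hb => rw [map_add]; exact Subalgebra.add_mem _ ha hb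
  | hmul a c ha => rw [map_mul]; exact Subalgebra.mul_mem _ ha (h c)

/-! ### The grading by monomial degree -/

/-- The homogeneous elements of degree `n`, where all `x_c` and `u` have degree `1`. The quantum
grading is an affine function of this degree. -/
noncomputable def homogeneous (Z : Type) (n : ℤ) : AddSubgroup (CircleAlgebra Z) :=
  AddSubgroup.closure {a | ∃ (S : Finset Z) (k : ℕ), (S.card + k : ℤ) = n ∧
    a = BNRing.u ^ k • gen S}

theorem smul_gen_mem {Z : Type} (S : Finset Z) (k : ℕ) :
    BNRing.u ^ k • gen S ∈ homogeneous Z (S.card + k) :=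
  AddSubgroup.subset_closure ⟨S, k, rfl, rfl⟩

/-- An algebra map to a graded algebra preserves degrees if it sends all `x_c` to elements of
degree `1` and if `u` has degree `1` in the target. -/
theorem map_homogeneous {Z B : Type} [CommRing B] [Algebra BNRing B] (G : ℤ → AddSubgroup B)
    [SetLike.GradedMonoid G] (hu : algebraMap BNRing B BNRing.u ∈ G 1)
    (f : CircleAlgebra Z →ₐ[BNRing] B) (hf : ∀ c, f (x c) ∈ G 1) {n : ℤ} {a : CircleAlgebra Z}
    (ha : a ∈ homogeneous Z n) : f a ∈ G n := by
  have hgen : ∀ S : Finset Z, f (gen S) ∈ G S.card := by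
    classical
    intro S
    induction S using Finset.induction_on with
    | empty =>
      rw [gen, Finset.prod_empty, map_one, Finset.card_empty]
      exact SetLike.one_mem_graded G
    | insert c S hc ih =>
      rw [gen, Finset.prod_insert hc, map_mul, Finset.card_insert_of_notMem hc, Nat.cast_add,
        Nat.cast_one, add_comm]
      exact SetLike.GradedMul.mul_mem (hf c) ih
  have hpow : ∀ k : ℕ, algebraMap BNRing B BNRing.u ^ k ∈ G k := by
    intro k
    have := SetLike.pow_mem_graded k hu
    simpa using this
  have hle : homogeneous Z n ≤ (G n).comap f.toLinearMap.toAddMonoidHom := by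
    refine (AddSubgroup.closure_le _).2 ?_
    rintro _ ⟨S, k, rfl, rfl⟩
    change f (BNRing.u ^ k • gen S) ∈ G _
    rw [map_smul, Algebra.smul_def, map_pow, add_comm]
    exact SetLike.GradedMul.mul_mem (hpow k) (hgen S)
  exact hle ha

theorem one_mem_homogeneous (Z : Type) : (1 : CircleAlgebra Z) ∈ homogeneous Z 0 := by
  simpa [gen] using smul_gen_mem (∅ : Finset Z) 0

theorem x_mem_homogeneous {Z : Type} (c : Z) : x c ∈ homogeneous Z 1 := by
  simpa [gen] using smul_gen_mem {c} 0

theorem u_mul_mem_homogeneous {Z : Type} {n : ℤ} {a : CircleAlgebra Z}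
    (ha : a ∈ homogeneous Z n) : u Z * a ∈ homogeneous Z (n + 1) := by
  have hle : homogeneous Z n ≤ (homogeneous Z (n + 1)).comap (AddMonoidHom.mulLeft (u Z)) := by
    refine (AddSubgroup.closure_le _).2 ?_
    rintro _ ⟨S, k, rfl, rfl⟩
    refine AddSubgroup.subset_closure ⟨S, k + 1, by push_cast; ring, ?_⟩
    change u Z * _ = _
    rw [u, ← Algebra.smul_def, smul_smul, pow_succ']
  exact hle ha

theorem x_mul_mem_homogeneous {Z : Type} (c : Z) {n : ℤ} {a : CircleAlgebra Z}
    (ha : a ∈ homogeneous Z n) : x c * a ∈ homogeneous Z (n + 1) := by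
  classical
  have hle : homogeneous Z n ≤ (homogeneous Z (n + 1)).comap (AddMonoidHom.mulLeft (x c)) := by
    refine (AddSubgroup.closure_le _).2 ?_
    rintro _ ⟨S, k, rfl, rfl⟩
    change x c * _ ∈ homogeneous Z _
    by_cases hc : c ∈ S
    · have h : x c * gen S = u Z * gen S := by
        rw [gen, ← Finset.mul_prod_erase S x hc, ← mul_assoc, x_sq, mul_assoc]
      rw [mul_smul_comm, h, ← mul_smul_comm]
      exact u_mul_mem_homogeneous (smul_gen_mem S k)
    · refine AddSubgroup.subset_closure ⟨insert c S, k, ?_, ?_⟩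
      · rw [Finset.card_insert_of_notMem hc]
        push_cast
        ring
      · rw [mul_smul_comm, gen, gen, Finset.prod_insert hc]
  exact hle ha

theorem mul_mem_homogeneous {Z : Type} {m n : ℤ} {a b : CircleAlgebra Z}
    (ha : a ∈ homogeneous Z m) (hb : b ∈ homogeneous Z n) : a * b ∈ homogeneous Z (m + n) := by
  classical
  have hgen : ∀ S : Finset Z, gen S * b ∈ homogeneous Z (S.card + n) := by
    intro S
    induction S using Finset.induction_on with
    | empty => simpa [gen] using hb
    | insert c S hc ih =>
      rw [gen, Finset.prod_insert hc, mul_assoc, Finset.card_insert_of_notMem hc, Nat.cast_add,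
        Nat.cast_one]
      have := x_mul_mem_homogeneous c ih
      rwa [add_right_comm] at this
  have hle : homogeneous Z m ≤ (homogeneous Z (m + n)).comap (AddMonoidHom.mulRight b) := by
    refine (AddSubgroup.closure_le _).2 ?_
    rintro _ ⟨S, k, rfl, rfl⟩
    change _ * b ∈ homogeneous Z _
    rw [smul_mul_assoc]
    clear ha
    induction k with
    | zero => simpa using hgen S
    | succ k ih =>
      rw [pow_succ', mul_smul, Algebra.smul_def, Nat.cast_add, Nat.cast_one, ← add_assoc,
        add_right_comm]
      exact u_mul_mem_homogeneous ih
  exact hle ha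

instance (Z : Type) : SetLike.GradedMonoid (homogeneous Z) where
  one_mem := one_mem_homogeneous Z
  mul_mem _ _ _ _ := mul_mem_homogeneous

theorem u_mem_homogeneous (Z : Type) : u Z ∈ homogeneous Z 1 := by
  simpa using u_mul_mem_homogeneous (one_mem_homogeneous Z)

theorem relabel_mem_homogeneous {Z Z' : Type} (f : Z → Z') {n : ℤ} {a : CircleAlgebra Z}
    (ha : a ∈ homogeneous Z n) : relabel f a ∈ homogeneous Z' n :=
  map_homogeneous (homogeneous Z') (u_mem_homogeneous Z') (relabel f)
    (fun c => by rw [relabel_x]; exact x_mem_homogeneous _) ha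

/-! ### Undoing multiplication by a generator -/

theorem quadratic_algebraMap_u (Z : Type) :
    algebraMap BNRing (QuadraticAlgebra (CircleAlgebra Z) 0 (u Z)) BNRing.u = ⟨u Z, 0⟩ := rfl

/-- The algebra map `x_c ↦ x_c + ω`, where `ω ^ 2 = u ω`. It fixes the unpointed subalgebra. -/
noncomputable def shift (Z : Type) :
    CircleAlgebra Z →ₐ[BNRing] QuadraticAlgebra (CircleAlgebra Z) 0 (u Z) :=
  lift (fun c => ⟨x c, 1⟩) fun c => by
    have h3 := two_mul_eq_zero (x c)
    rw [quadratic_algebraMap_u]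
    ext
    · simp [x_sq]
    · simp [h3]

theorem shift_of_mem_unpointed {Z : Type} {a : CircleAlgebra Z} (ha : a ∈ unpointed Z) :
    shift Z a = ⟨a, 0⟩ := by
  have h : shift Z a =
      IsScalarTower.toAlgHom BNRing (CircleAlgebra Z)
        (QuadraticAlgebra (CircleAlgebra Z) 0 (u Z)) a := by
    refine eqOn_unpointed (fun c c' => ?_) ha
    rw [map_add, shift, lift_x, lift_x]
    ext
    · simp
    · simp [two_mul_eq_zero]
  exact h

/-- The coefficient of `ω` in `shift`: a linear map of degree `-1`, which satisfies
`contract (x_c * a) = a` for all `a` in the unpointed subalgebra. -/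
noncomputable def contract (Z : Type) : CircleAlgebra Z →ₗ[BNRing] CircleAlgebra Z where
  toFun a := (shift Z a).im
  map_add' a b := by rw [map_add, QuadraticAlgebra.im_add]
  map_smul' r a := by rw [map_smul, QuadraticAlgebra.im_smul, RingHom.id_apply]

theorem contract_x_mul {Z : Type} (c : Z) {a : CircleAlgebra Z} (ha : a ∈ unpointed Z) :
    contract Z (x c * a) = a := by
  change (shift Z (x c * a)).im = a
  rw [map_mul, shift_of_mem_unpointed ha, shift, lift_x]
  simp

/-- The grading of `A[ω]`, for `A` a circle algebra, in which `ω` has degree `1`. -/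
noncomputable def quadraticHomogeneous (Z : Type) (n : ℤ) :
    AddSubgroup (QuadraticAlgebra (CircleAlgebra Z) 0 (u Z)) where
  carrier := {z | z.re ∈ homogeneous Z n ∧ z.im ∈ homogeneous Z (n - 1)}
  zero_mem' := ⟨zero_mem _, zero_mem _⟩
  add_mem' ha hb := ⟨add_mem ha.1 hb.1, add_mem ha.2 hb.2⟩
  neg_mem' ha := ⟨neg_mem ha.1, neg_mem ha.2⟩

instance (Z : Type) : SetLike.GradedMonoid (quadraticHomogeneous Z) where
  one_mem := ⟨one_mem_homogeneous Z, zero_mem _⟩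
  mul_mem m n z w hz hw := by
    refine ⟨?_, ?_⟩
    · rw [QuadraticAlgebra.re_mul, zero_mul, zero_mul, add_zero]
      exact mul_mem_homogeneous hz.1 hw.1
    · rw [QuadraticAlgebra.im_mul]
      refine add_mem (add_mem ?_ ?_) ?_
      · rw [add_sub_assoc]
        exact mul_mem_homogeneous hz.1 hw.2
      · rw [add_sub_right_comm]
        exact mul_mem_homogeneous hz.2 hw.1
      · have h := u_mul_mem_homogeneous (mul_mem_homogeneous hz.2 hw.2)
        rw [mul_assoc]
        convert h using 2
        ring

theorem contract_mem_homogeneous {Z : Type} {n : ℤ} {a : CircleAlgebra Z}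
    (ha : a ∈ homogeneous Z n) : contract Z a ∈ homogeneous Z (n - 1) := by
  refine (map_homogeneous (quadraticHomogeneous Z) ?_ (shift Z) (fun c => ?_) ha).2
  · rw [quadratic_algebraMap_u]
    exact ⟨u_mem_homogeneous Z, zero_mem _⟩
  · rw [shift, lift_x]
    exact ⟨x_mem_homogeneous c, by simpa using one_mem_homogeneous Z⟩

/-- The algebra map `x_c ↦ x_c + x_p`, a projection onto the unpointed subalgebra. -/
noncomputable def shear {Z : Type} (p : Z) : CircleAlgebra Z →ₐ[BNRing] CircleAlgebra Z :=
  lift (fun c => x c + x p) fun c => add_mul_add c p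

@[simp] theorem shear_x {Z : Type} (p c : Z) : shear p (x c) = x c + x p := lift_x _ _ c

theorem shear_mem_unpointed {Z : Type} (p : Z) (a : CircleAlgebra Z) :
    shear p a ∈ unpointed Z :=
  mem_unpointed_of_generators (fun c => by rw [shear_x]; exact add_mem_unpointed c p) a

theorem shear_of_mem_unpointed {Z : Type} (p : Z) {a : CircleAlgebra Z} (ha : a ∈ unpointed Z) :
    shear p a = a := by
  refine eqOn_unpointed (g := AlgHom.id BNRing _) (fun c c' => ?_) ha
  have h := two_mul_eq_zero (x p)
  rw [map_add, shear_x, shear_x, AlgHom.id_apply]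
  linear_combination h

/-- Multiplication by `x_p` maps the unpointed subalgebra onto the pointed submodule, since
`x_p x_c = x_p (x_c + x_p + u)`. -/
theorem exists_unpointed_of_mem_pointed {Z : Type} {p : Z} {a : CircleAlgebra Z}
    (ha : a ∈ pointed p) : ∃ b ∈ unpointed Z, x p * b = a := by
  obtain ⟨b, rfl⟩ := mem_pointed.1 ha
  have hf : ∀ c, (x c + x p + u Z) * (x c + x p + u Z) =
      algebraMap BNRing (CircleAlgebra Z) BNRing.u * (x c + x p + u Z) := by
    intro c
    change _ = u Z * _
    have h1 := add_mul_add c p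
    have h2 := two_mul_eq_zero (u Z * (x c + x p))
    linear_combination h1 + h2
  refine ⟨lift _ hf b, mem_unpointed_of_generators (fun c => ?_) b,
    mul_map_eq _ (AlgHom.id BNRing _) (x p) (fun c => ?_) b⟩
  · rw [lift_x]
    exact Subalgebra.add_mem _ (add_mem_unpointed c p) (Subalgebra.algebraMap_mem _ _)
  · rw [lift_x, AlgHom.id_apply]
    have h1 := x_sq p
    have h2 := two_mul_eq_zero (u Z * x p)
    linear_combination h1 + h2

end CircleAlgebra

/-! ### Equivariant isomorphisms -/

namespace InvolutiveComplex

namespace EquivariantIso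

/-- The inverse of an equivariant isomorphism. -/
noncomputable def symm {A B : InvolutiveComplex} (e : EquivariantIso A B) : EquivariantIso B A where
  toLinearEquiv := e.toLinearEquiv.symm
  map_d b := by
    rw [LinearEquiv.symm_apply_eq, e.map_d, LinearEquiv.apply_symm_apply]
  map_tau b := by
    rw [LinearEquiv.symm_apply_eq, e.map_tau, LinearEquiv.apply_symm_apply]
  map_homogeneous i j b := by
    rw [← e.map_homogeneous, LinearEquiv.apply_symm_apply]

/-- The composite of equivariant isomorphisms. -/
noncomputable def trans {A B C : InvolutiveComplex} (e : EquivariantIso A B)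
    (f : EquivariantIso B C) : EquivariantIso A C where
  toLinearEquiv := e.toLinearEquiv.trans f.toLinearEquiv
  map_d a := by
    rw [LinearEquiv.trans_apply, e.map_d, f.map_d, LinearEquiv.trans_apply]
  map_tau a := by
    rw [LinearEquiv.trans_apply, e.map_tau, f.map_tau, LinearEquiv.trans_apply]
  map_homogeneous i j a := by
    rw [LinearEquiv.trans_apply, f.map_homogeneous, e.map_homogeneous]

theorem tensor_homogeneous {A A' B B' : InvolutiveComplex} (e : EquivariantIso A A')
    (f : EquivariantIso B B') {i j : ℤ} {t : (A.tensor B).carrier}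
    (ht : t ∈ (A.tensor B).homogeneous i j) :
    TensorProduct.congr e.toLinearEquiv f.toLinearEquiv t ∈ (A'.tensor B').homogeneous i j := by
  have hle : (A.tensor B).homogeneous i j ≤ ((A'.tensor B').homogeneous i j).comap
      (TensorProduct.congr e.toLinearEquiv f.toLinearEquiv).toLinearMap.toAddMonoidHom := by
    refine (AddSubgroup.closure_le _).2 ?_
    rintro _ ⟨i₁, i₂, j₁, j₂, a, b, hi, hj, ha, hb, rfl⟩
    exact AddSubgroup.subset_closure ⟨i₁, i₂, j₁, j₂, e.toLinearEquiv a, f.toLinearEquiv b, hi, hj,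
      (e.map_homogeneous _ _ _).2 ha, (f.map_homogeneous _ _ _).2 hb, rfl⟩
  exact hle ht

/-- The tensor product of equivariant isomorphisms. -/
noncomputable def tensor {A A' B B' : InvolutiveComplex} (e : EquivariantIso A A')
    (f : EquivariantIso B B') : EquivariantIso (A.tensor B) (A'.tensor B') where
  toLinearEquiv := TensorProduct.congr e.toLinearEquiv f.toLinearEquiv
  map_d t := by
    have h : (TensorProduct.congr e.toLinearEquiv f.toLinearEquiv).toLinearMap ∘ₗ
          (TensorProduct.map A.d LinearMap.id + TensorProduct.map LinearMap.id B.d) =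
        (TensorProduct.map A'.d LinearMap.id + TensorProduct.map LinearMap.id B'.d) ∘ₗ
          (TensorProduct.congr e.toLinearEquiv f.toLinearEquiv).toLinearMap := by
      refine TensorProduct.ext' fun a b => ?_
      simp [e.map_d, f.map_d]
    exact LinearMap.congr_fun h t
  map_tau t := by
    have h : (TensorProduct.congr e.toLinearEquiv f.toLinearEquiv).toLinearMap ∘ₗ
          TensorProduct.map A.tau B.tau =
        TensorProduct.map A'.tau B'.tau ∘ₗ
          (TensorProduct.congr e.toLinearEquiv f.toLinearEquiv).toLinearMap := by
      refine TensorProduct.ext' fun a b => ?_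
      simp [e.map_tau, f.map_tau]
    exact LinearMap.congr_fun h t
  map_homogeneous i j t := by
    refine ⟨fun h => ?_, tensor_homogeneous e f⟩
    have h' := tensor_homogeneous e.symm f.symm h
    have hs : TensorProduct.congr e.symm.toLinearEquiv f.symm.toLinearEquiv
        (TensorProduct.congr e.toLinearEquiv f.toLinearEquiv t) = t :=
      (TensorProduct.congr e.toLinearEquiv f.toLinearEquiv).symm_apply_apply t
    exact hs ▸ h'

end EquivariantIso

end InvolutiveComplex

/-! ### The bigrading and the edge maps -/

namespace KnotDiagram

/-- The quantum grading of the generator `1` at `v`. -/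
noncomputable def grOne (D : KnotDiagram) (v : D.Resolution) : ℤ :=
  (Nat.card (D.Circle v) : ℤ) + D.weight v + D.nPlus - 2 * D.nMinus

/-- A monomial of degree `n` at `v` has quantum grading `grOne v - 2 * n`, since both `u` and a
label `x` lower the quantum grading by `2`. -/
theorem single_mem_homogeneous (D : KnotDiagram) {v : D.Resolution} {n i j : ℤ}
    (hi : D.grH v = i) (hj : D.grOne v - 2 * n = j) {a : CircleAlgebra (D.Circle v)}
    (ha : a ∈ CircleAlgebra.homogeneous (D.Circle v) n) :
    (Pi.single v a : D.Chain) ∈ D.homogeneous i j := by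
  have hle : CircleAlgebra.homogeneous (D.Circle v) n ≤ (D.homogeneous i j).comap
      (AddMonoidHom.single (fun v => CircleAlgebra (D.Circle v)) v) := by
    refine (AddSubgroup.closure_le _).2 ?_
    rintro _ ⟨S, k, rfl, rfl⟩
    refine AddSubgroup.subset_closure ⟨v, S, k, hi, ?_, rfl⟩
    rw [← hj, grQ, grOne]
    ring
  exact hle ha

/-- That a linear map sends homogeneous chains to a given subgroup may be checked on chains
concentrated at one resolution. -/
theorem map_mem_of_mem_homogeneous (D : KnotDiagram) {M : Type} [AddCommGroup M]
    [Module BNRing M] (f : D.Chain →ₗ[BNRing] M) (K : AddSubgroup M) {i j : ℤ}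
    (h : ∀ (v : D.Resolution) (n : ℤ) (a : CircleAlgebra (D.Circle v)), D.grH v = i →
      D.grOne v - 2 * n = j → a ∈ CircleAlgebra.homogeneous (D.Circle v) n →
        f (Pi.single v a) ∈ K) {a : D.Chain} (ha : a ∈ D.homogeneous i j) : f a ∈ K := by
  have hle : D.homogeneous i j ≤ K.comap f.toAddMonoidHom := by
    refine (AddSubgroup.closure_le _).2 ?_
    rintro _ ⟨v, S, k, hi, hj, rfl⟩
    refine h v (S.card + k) _ hi ?_ (CircleAlgebra.smul_gen_mem S k)
    rw [← hj, grQ, grOne]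
    ring
  exact hle ha

/-- The map of chains given by a linear map at each resolution. -/
noncomputable def chainMap (D : KnotDiagram)
    (f : ∀ v, CircleAlgebra (D.Circle v) →ₗ[BNRing] CircleAlgebra (D.Circle v)) :
    D.Chain →ₗ[BNRing] D.Chain :=
  LinearMap.pi fun v => f v ∘ₗ LinearMap.proj v

/-- A chain map that shifts the degree of monomials by `m` shifts the quantum grading
by `-2 * m`. -/
theorem chainMap_mem_homogeneous (D : KnotDiagram)
    (f : ∀ v, CircleAlgebra (D.Circle v) →ₗ[BNRing] CircleAlgebra (D.Circle v)) (m : ℤ)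
    (hf : ∀ v n a, a ∈ CircleAlgebra.homogeneous (D.Circle v) n →
      f v a ∈ CircleAlgebra.homogeneous (D.Circle v) (n + m)) {i j : ℤ} {a : D.Chain}
    (ha : a ∈ D.homogeneous i j) : D.chainMap f a ∈ D.homogeneous i (j - 2 * m) := by
  refine D.map_mem_of_mem_homogeneous (D.chainMap f) _ (fun v n b hi hj hb => ?_) ha
  have h : D.chainMap f (Pi.single v b) = Pi.single v (f v b) := by
    funext w
    exact Pi.apply_single (fun v => f v) (fun v => map_zero (f v)) v b w
  rw [h]
  exact D.single_mem_homogeneous hi (by rw [← hj]; ring) (hf v n b hb)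

open Classical in
/-- The factor `1` of a merge, or `x_β + x_γ + u` of a split, in the edge map at `c`. -/
noncomputable def edgeFactor (D : KnotDiagram) (c : D.Crossing) (w : D.Resolution) :
    CircleAlgebra (D.Circle w) :=
  if D.circle w (D.lower c) = D.circle w (D.next (D.lower c)) then 1
  else CircleAlgebra.x (D.circle w (D.lower c)) +
    CircleAlgebra.x (D.circle w (D.next (D.lower c))) + CircleAlgebra.u (D.Circle w)

theorem edgeMap_apply (D : KnotDiagram) (c : D.Crossing) (v w : D.Resolution)
    (a : CircleAlgebra (D.Circle v)) :
    D.edgeMap c v w a = D.edgeFactor c w * CircleAlgebra.relabel (D.carry v w) a := by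
  unfold edgeMap edgeFactor
  split_ifs
  · rw [one_mul, AlgHom.toLinearMap_apply]
  · rfl

/-- After multiplication by the factor of the edge map, `carry` may be computed on any edge of a
circle, and not only on the representative chosen in its definition. -/
theorem edgeFactor_mul_carry (D : KnotDiagram) {c : D.Crossing} {v w : D.Resolution}
    (hv : v = Function.update w c false) (hw : w c = true) (e : D.Edge) :
    D.edgeFactor c w * CircleAlgebra.x (D.carry v w (D.circle v e)) =
      D.edgeFactor c w * CircleAlgebra.x (D.circle w e) := by
  subst hv
  have hout : D.circle (Function.update w c false)
      (D.circle (Function.update w c false) e).out =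
        D.circle (Function.update w c false) e := Quotient.out_eq _
  have key := D.circle_update c w hw hout
  have hcarry : D.carry (Function.update w c false) w
      (D.circle (Function.update w c false) e) =
        D.circle w (D.circle (Function.update w c false) e).out := rfl
  rw [hcarry]
  unfold edgeFactor
  split_ifs with hm
  · rw [← hm, or_self, or_self] at key
    rcases key with key | ⟨h2, h3⟩
    · rw [key]
    · rw [h2, h3]
  · have hs := CircleAlgebra.split_mul (D.circle w (D.lower c))
      (D.circle w (D.next (D.lower c)))
    rcases key with key | ⟨h2, h3⟩
    · rw [key]
    · rcases h2 with h2 | h2 <;> rcases h3 with h3 | h3 <;> rw [h2, h3]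
      · exact hs
      · exact hs.symm

theorem relabel_edgeFactor (D D' : KnotDiagram) {c : D.Crossing} {c' : D'.Crossing}
    {w : D.Resolution} {w' : D'.Resolution} {h : D.Circle w → D'.Circle w'}
    (hinj : Function.Injective h) (hS : h (D.circle w (D.lower c)) = D'.circle w' (D'.lower c'))
    (hN : h (D.circle w (D.next (D.lower c))) = D'.circle w' (D'.next (D'.lower c'))) :
    CircleAlgebra.relabel h (D.edgeFactor c w) = D'.edgeFactor c' w' := by
  unfold edgeFactor
  rw [← hS, ← hN]
  by_cases hc : D.circle w (D.lower c) = D.circle w (D.next (D.lower c))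
  · rw [if_pos hc, if_pos (congrArg h hc), map_one]
  · rw [if_neg hc, if_neg (hinj.ne hc), map_add, map_add, CircleAlgebra.relabel_x,
      CircleAlgebra.relabel_x, CircleAlgebra.u, AlgHom.commutes, CircleAlgebra.u]

/-- Edge maps commute with multiplication by the generator of the circle through a fixed edge. -/
theorem edgeMap_x_mul (D : KnotDiagram) {c : D.Crossing} {v w : D.Resolution}
    (hv : v = Function.update w c false) (hw : w c = true) (e : D.Edge)
    (a : CircleAlgebra (D.Circle v)) :
    D.edgeMap c v w (CircleAlgebra.x (D.circle v e) * a) =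
      CircleAlgebra.x (D.circle w e) * D.edgeMap c v w a := by
  rw [edgeMap_apply, edgeMap_apply, map_mul, CircleAlgebra.relabel_x, ← mul_assoc,
    D.edgeFactor_mul_carry hv hw, mul_right_comm, mul_comm]

theorem differential_apply (D : KnotDiagram) (a : D.Chain) (w : D.Resolution) :
    D.differential a w = ∑ c : D.Crossing, if w c = true then
      D.edgeMap c (Function.update w c false) w (a (Function.update w c false)) else 0 := by
  rw [differential, LinearMap.pi_apply, LinearMap.sum_apply]
  refine Finset.sum_congr rfl fun c _ => ?_
  split_ifs <;> rfl

end KnotDiagram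

/-! ### The pointed and the unpointed complex -/

namespace TransvergentDiagram

theorem tauCircle_fixedPoint (D : TransvergentDiagram) (p : D.FixedPoint) (w : D.Resolution) :
    D.tauCircle w (D.circle (D.tauR w) p.1) = D.circle w p.1 := by
  have h1 : D.tauCircle w (D.circle (D.tauR w) p.1) = D.circle w (D.tauE p.1) := rfl
  rw [h1, p.2]
  exact (D.circle_eq_of_joined (.marked _ (D.marked_fixedPoint p))).symm

/-- Multiplication by `x_{c_p}` on the whole complex. -/
noncomputable def mulBasepoint (D : TransvergentDiagram) (p : D.FixedPoint) :
    D.Chain →ₗ[BNRing] D.Chain :=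
  D.chainMap fun v => LinearMap.mulLeft BNRing (CircleAlgebra.x (D.circle v p.1))

theorem mulBasepoint_apply (D : TransvergentDiagram) (p : D.FixedPoint) (a : D.Chain)
    (v : D.Resolution) :
    D.mulBasepoint p a v = CircleAlgebra.x (D.circle v p.1) * a v := rfl

theorem mulBasepoint_differential (D : TransvergentDiagram) (p : D.FixedPoint) (a : D.Chain) :
    D.mulBasepoint p (D.differential a) = D.differential (D.mulBasepoint p a) := by
  funext w
  rw [mulBasepoint_apply, D.differential_apply, D.differential_apply, Finset.mul_sum]
  refine Finset.sum_congr rfl fun c _ => ?_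
  split_ifs with hw
  · rw [mulBasepoint_apply, D.edgeMap_x_mul rfl hw]
  · rw [mul_zero]

theorem mulBasepoint_tau (D : TransvergentDiagram) (p : D.FixedPoint) (a : D.Chain) :
    D.mulBasepoint p (D.tau a) = D.tau (D.mulBasepoint p a) := by
  funext w
  change CircleAlgebra.x (D.circle w p.1) * CircleAlgebra.relabel (D.tauCircle w) (a (D.tauR w)) =
    CircleAlgebra.relabel (D.tauCircle w)
      (CircleAlgebra.x (D.circle (D.tauR w) p.1) * a (D.tauR w))
  rw [map_mul, CircleAlgebra.relabel_x, tauCircle_fixedPoint]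

/-- Multiplication by `x_{c_p}`, as an isomorphism from the unpointed to the pointed complex. -/
noncomputable def unpointedEquivPointed (D : TransvergentDiagram) (p : D.FixedPoint) :
    D.unpointedReduced ≃ₗ[BNRing] D.pointedReduced p.1 where
  toFun a := ⟨D.mulBasepoint p a, fun _ _ => CircleAlgebra.mem_pointed.2 ⟨_, rfl⟩⟩
  map_add' a b := Subtype.ext (map_add (D.mulBasepoint p) _ _)
  map_smul' r a := Subtype.ext (map_smul (D.mulBasepoint p) _ _)
  invFun b := ⟨D.chainMap (fun v => CircleAlgebra.contract (D.Circle v)) b, fun v _ => by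
    obtain ⟨a, ha, h⟩ := CircleAlgebra.exists_unpointed_of_mem_pointed (b.2 v (Set.mem_univ v))
    change CircleAlgebra.contract (D.Circle v) (b.1 v) ∈ CircleAlgebra.unpointed _
    rw [← h, CircleAlgebra.contract_x_mul _ ha]
    exact ha⟩
  left_inv a := Subtype.ext <| funext fun v =>
    CircleAlgebra.contract_x_mul _ (a.2 v (Set.mem_univ v))
  right_inv b := Subtype.ext <| funext fun v => by
    obtain ⟨a, ha, h⟩ := CircleAlgebra.exists_unpointed_of_mem_pointed (b.2 v (Set.mem_univ v))
    change CircleAlgebra.x _ * CircleAlgebra.contract (D.Circle v) (b.1 v) = b.1 v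
    rw [← h, CircleAlgebra.contract_x_mul _ ha]

/-- The unpointed and the pointed reduced complexes are equivariantly isomorphic. -/
noncomputable def unpointedIsoPointed (D : TransvergentDiagram) (p : D.FixedPoint) :
    InvolutiveComplex.EquivariantIso (D.reduced .unpointed) (D.reduced (.pointed p)) where
  toLinearEquiv := D.unpointedEquivPointed p
  map_d a := Subtype.ext (D.mulBasepoint_differential p a.1)
  map_tau a := Subtype.ext (D.mulBasepoint_tau p a.1)
  map_homogeneous i j a := by
    change D.mulBasepoint p a.1 ∈ D.homogeneous i (j - 1) ↔ a.1 ∈ D.homogeneous i (j + 1)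
    constructor
    · intro h
      -- `contract` is homogeneous on all of the complex, and not only on the pointed part.
      have h' := D.chainMap_mem_homogeneous (fun v => CircleAlgebra.contract (D.Circle v)) (-1)
        (fun v n a => CircleAlgebra.contract_mem_homogeneous) h
      have ha : D.chainMap (fun v => CircleAlgebra.contract (D.Circle v)) (D.mulBasepoint p a.1) =
          a.1 := congrArg Subtype.val ((D.unpointedEquivPointed p).left_inv a)
      rw [ha] at h'
      convert h' using 2
      ring
    · intro h
      have h' := D.chainMap_mem_homogeneous
        (fun v => LinearMap.mulLeft BNRing (CircleAlgebra.x (D.circle v p.1))) 1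
        (fun v n a => CircleAlgebra.x_mul_mem_homogeneous _) h
      have hj : j - 1 = j + 1 - 2 * 1 := by ring
      rw [hj]
      exact h'

theorem nonempty_iso_unpointed (D : TransvergentDiagram) (m : D.ReducedModel) :
    Nonempty (InvolutiveComplex.EquivariantIso (D.reduced m) (D.reduced .unpointed)) := by
  cases m with
  | unpointed => exact ⟨⟨LinearEquiv.refl _ _, fun _ => rfl, fun _ => rfl, fun _ _ _ => Iff.rfl⟩⟩
  | pointed p => exact ⟨(D.unpointedIsoPointed p).symm⟩

end TransvergentDiagram

/-! ### Functions on circles -/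

namespace KnotDiagram

/-- A function on edges that is constant along the joints of `v` descends to circles. -/
def circleLift (D : KnotDiagram) (v : D.Resolution) {T : Type} (F : D.Edge → T)
    (h : ∀ e e', D.Joined v e e' → F e = F e') : D.Circle v → T :=
  Quotient.lift F fun e e' hee => by
    have hee' : Relation.EqvGen (D.Joined v) e e' := hee
    clear hee
    induction hee' with
    | rel a b hab => exact h a b hab
    | refl a => rfl
    | symm a b _ ih => exact ih.symm
    | trans a b c _ _ ih1 ih2 => exact ih1.trans ih2

/-- Every edge ends at a marked point or at one strand of one crossing. In the sum over all edges
`e` of `f e + f (next e)` every edge occurs twice, so that the sum vanishes modulo two; if the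
contributions of all vertices but one vanish, then so does that of the last one. -/
theorem eq_next_of_zmod_two (D : KnotDiagram) (f : D.Edge → ZMod 2) (p : D.Edge)
    (hp : D.Marked p) (hm : ∀ e, D.Marked e → e ≠ p → f e = f (D.next e))
    (hc : ∀ c, f (D.lower c) + f (D.next (D.lower c)) +
      (f (D.upper c) + f (D.next (D.upper c))) = 0) : f p = f (D.next p) := by
  have htotal : ∑ e, (f e + f (D.next e)) = 0 := by
    rw [Finset.sum_add_distrib, Equiv.sum_comp D.next f]
    exact CharTwo.add_self_eq_zero _
  have himage : ∑ e ∈ Finset.univ.image (Sum.elim D.lower D.upper), (f e + f (D.next e)) = 0 := by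
    rw [Finset.sum_image fun a _ b _ h => D.injective h, Fintype.sum_sum_type,
      ← Finset.sum_add_distrib]
    exact Finset.sum_eq_zero fun c _ => hc c
  have hnot : ∀ e, e ∉ Finset.univ.image (Sum.elim D.lower D.upper) ↔ D.Marked e := by
    intro e
    simp [Marked, forall_and]
  have hrest : ∑ e ∈ (Finset.univ.image (Sum.elim D.lower D.upper))ᶜ,
      (f e + f (D.next e)) = f p + f (D.next p) := by
    refine Finset.sum_eq_single_of_mem p ?_ fun e he hne => ?_
    · rw [Finset.mem_compl, hnot]
      exact hp
    · rw [Finset.mem_compl, hnot] at he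
      rw [← hm e he hne]
      exact CharTwo.add_self_eq_zero _
  rw [← Finset.sum_add_sum_compl (Finset.univ.image (Sum.elim D.lower D.upper)), himage, hrest,
    zero_add] at htotal
  exact CharTwo.add_eq_zero.1 htotal

/-- A circle that is cut open at a marked point `p` remains connected: a function on edges that is
constant along all joints of `v` other than `p` is also constant along `p`. -/
theorem eq_next_of_cut (D : KnotDiagram) (v : D.Resolution) {T : Type} (F : D.Edge → T)
    (p : D.Edge) (hp : D.Marked p) (hm : ∀ e, D.Marked e → e ≠ p → F e = F (D.next e))
    (h0 : ∀ c, v c = false → F (D.lower c) = F (D.east c) ∧ F (D.next (D.lower c)) = F (D.west c))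
    (h1 : ∀ c, v c = true → F (D.lower c) = F (D.west c) ∧ F (D.next (D.lower c)) = F (D.east c)) :
    F p = F (D.next p) := by
  classical
  -- the indicator function of the edges on which `F` takes the same value as on `p`
  have h := D.eq_next_of_zmod_two (fun e => if F e = F p then 1 else 0) p hp
    (fun e he hne => by rw [hm e he hne]) (fun c => ?_)
  · by_contra hne
    simp [Ne.symm hne] at h
  · have key : F (D.lower c) = F (D.upper c) ∧ F (D.next (D.lower c)) = F (D.next (D.upper c)) ∨
        F (D.lower c) = F (D.next (D.upper c)) ∧ F (D.next (D.lower c)) = F (D.upper c) := by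
      have h0 := h0 c
      have h1 := h1 c
      unfold east west at h0 h1
      cases hv : v c <;> cases hpos : D.positive c <;> simp [hv, hpos] at h0 h1 <;> tauto
    rcases key with ⟨h2, h3⟩ | ⟨h2, h3⟩
    · simp only [h2, h3]
      exact CharTwo.add_self_eq_zero _
    · simp only [h2, h3]
      rw [add_comm (ite (F (D.upper c) = F p) _ _)]
      exact CharTwo.add_self_eq_zero _

end KnotDiagram

/-! ### The circles of a connected sum -/

namespace TransvergentDiagram

section orientedSum

variable (D₁ : TransvergentDiagram) (p₁ : D₁.FixedPoint) (D₂ : TransvergentDiagram)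
  (p₂ : D₂.FixedPoint)

theorem next_inl_of_ne {e : D₁.Edge} (h : e ≠ p₁.1) :
    (orientedSum D₁ p₁ D₂ p₂).next (Sum.inl e) = Sum.inl (D₁.next e) :=
  splice_inl_of_ne _ _ _ _ h

theorem next_inr_of_ne {e : D₂.Edge} (h : e ≠ p₂.1) :
    (orientedSum D₁ p₁ D₂ p₂).next (Sum.inr e) = Sum.inr (D₂.next e) :=
  splice_inr_of_ne _ _ _ _ h

theorem next_inl_fixedPoint :
    (orientedSum D₁ p₁ D₂ p₂).next (Sum.inl p₁.1) = Sum.inr (D₂.next p₂.1) :=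
  splice_inl _ _ _ _

theorem next_inr_fixedPoint :
    (orientedSum D₁ p₁ D₂ p₂).next (Sum.inr p₂.1) = Sum.inl (D₁.next p₁.1) :=
  splice_inr _ _ _ _

theorem next_lower_inl (c : D₁.Crossing) :
    (orientedSum D₁ p₁ D₂ p₂).next ((orientedSum D₁ p₁ D₂ p₂).lower (Sum.inl c)) =
      Sum.inl (D₁.next (D₁.lower c)) :=
  next_inl_of_ne _ _ _ _ (D₁.marked_fixedPoint p₁ c).1

theorem next_lower_inr (c : D₂.Crossing) :
    (orientedSum D₁ p₁ D₂ p₂).next ((orientedSum D₁ p₁ D₂ p₂).lower (Sum.inr c)) =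
      Sum.inr (D₂.next (D₂.lower c)) :=
  next_inr_of_ne _ _ _ _ (D₂.marked_fixedPoint p₂ c).1

theorem next_upper_inl (c : D₁.Crossing) :
    (orientedSum D₁ p₁ D₂ p₂).next ((orientedSum D₁ p₁ D₂ p₂).upper (Sum.inl c)) =
      Sum.inl (D₁.next (D₁.upper c)) :=
  next_inl_of_ne _ _ _ _ (D₁.marked_fixedPoint p₁ c).2

theorem next_upper_inr (c : D₂.Crossing) :
    (orientedSum D₁ p₁ D₂ p₂).next ((orientedSum D₁ p₁ D₂ p₂).upper (Sum.inr c)) =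
      Sum.inr (D₂.next (D₂.upper c)) :=
  next_inr_of_ne _ _ _ _ (D₂.marked_fixedPoint p₂ c).2

theorem east_inl (c : D₁.Crossing) :
    (orientedSum D₁ p₁ D₂ p₂).east (Sum.inl c) = Sum.inl (D₁.east c) := by
  unfold KnotDiagram.east
  rw [next_upper_inl, apply_ite Sum.inl]
  rfl

theorem east_inr (c : D₂.Crossing) :
    (orientedSum D₁ p₁ D₂ p₂).east (Sum.inr c) = Sum.inr (D₂.east c) := by
  unfold KnotDiagram.east
  rw [next_upper_inr, apply_ite Sum.inr]
  rfl

theorem west_inl (c : D₁.Crossing) :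
    (orientedSum D₁ p₁ D₂ p₂).west (Sum.inl c) = Sum.inl (D₁.west c) := by
  unfold KnotDiagram.west
  rw [next_upper_inl, apply_ite Sum.inl]
  rfl

theorem west_inr (c : D₂.Crossing) :
    (orientedSum D₁ p₁ D₂ p₂).west (Sum.inr c) = Sum.inr (D₂.west c) := by
  unfold KnotDiagram.west
  rw [next_upper_inr, apply_ite Sum.inr]
  rfl

theorem marked_inl {e : D₁.Edge} :
    (orientedSum D₁ p₁ D₂ p₂).Marked (Sum.inl e) ↔ D₁.Marked e := by
  refine ⟨fun h c => ⟨fun hc => (h (Sum.inl c)).1 (congrArg Sum.inl hc),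
    fun hc => (h (Sum.inl c)).2 (congrArg Sum.inl hc)⟩, fun h => ?_⟩
  rintro (c | c)
  · exact ⟨fun hc => (h c).1 (Sum.inl.inj hc), fun hc => (h c).2 (Sum.inl.inj hc)⟩
  · exact ⟨fun hc => Sum.inr_ne_inl hc, fun hc => Sum.inr_ne_inl hc⟩

theorem marked_inr {e : D₂.Edge} :
    (orientedSum D₁ p₁ D₂ p₂).Marked (Sum.inr e) ↔ D₂.Marked e := by
  refine ⟨fun h c => ⟨fun hc => (h (Sum.inr c)).1 (congrArg Sum.inr hc),
    fun hc => (h (Sum.inr c)).2 (congrArg Sum.inr hc)⟩, fun h => ?_⟩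
  rintro (c | c)
  · exact ⟨fun hc => Sum.inl_ne_inr hc, fun hc => Sum.inl_ne_inr hc⟩
  · exact ⟨fun hc => (h c).1 (Sum.inr.inj hc), fun hc => (h c).2 (Sum.inr.inj hc)⟩

variable {D₁ p₁ D₂ p₂}

/-- The restriction of a resolution of the connected sum to the first diagram. -/
def resLeft (v : (orientedSum D₁ p₁ D₂ p₂).Resolution) : D₁.Resolution := fun c => v (Sum.inl c)

/-- The restriction of a resolution of the connected sum to the second diagram. -/
def resRight (v : (orientedSum D₁ p₁ D₂ p₂).Resolution) : D₂.Resolution := fun c => v (Sum.inr c)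

variable (v : (orientedSum D₁ p₁ D₂ p₂).Resolution)

/-- The circle of the connected sum that contains, or is formed from, a circle of the first
diagram. -/
def circleLeft : D₁.Circle (resLeft v) → (orientedSum D₁ p₁ D₂ p₂).Circle v :=
  D₁.circleLift (resLeft v) (fun e => (orientedSum D₁ p₁ D₂ p₂).circle v (Sum.inl e)) (by
    have hm : ∀ e, D₁.Marked e → e ≠ p₁.1 → (orientedSum D₁ p₁ D₂ p₂).circle v (Sum.inl e) =
        (orientedSum D₁ p₁ D₂ p₂).circle v (Sum.inl (D₁.next e)) := by
      intro e he hne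
      have := KnotDiagram.circle_eq_of_joined _
        (.marked (v := v) _ ((marked_inl D₁ p₁ D₂ p₂).2 he))
      rwa [next_inl_of_ne _ _ _ _ hne] at this
    have hzS := fun c h => (orientedSum D₁ p₁ D₂ p₂).circle_eq_of_joined
      (.zeroSouth (v := v) (Sum.inl c) h)
    have hzN := fun c h => (orientedSum D₁ p₁ D₂ p₂).circle_eq_of_joined
      (.zeroNorth (v := v) (Sum.inl c) h)
    have hoS := fun c h => (orientedSum D₁ p₁ D₂ p₂).circle_eq_of_joined
      (.oneSouth (v := v) (Sum.inl c) h)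
    have hoN := fun c h => (orientedSum D₁ p₁ D₂ p₂).circle_eq_of_joined
      (.oneNorth (v := v) (Sum.inl c) h)
    simp only [next_lower_inl, east_inl, west_inl] at hzS hzN hoS hoN
    intro e e' h
    cases h with
    | marked _ h =>
      by_cases hp : e = p₁.1
      · subst hp
        exact D₁.eq_next_of_cut (resLeft v) _ _ h hm (fun c hc => ⟨hzS c hc, hzN c hc⟩)
          (fun c hc => ⟨hoS c hc, hoN c hc⟩)
      · exact hm e h hp
    | zeroSouth c h => exact hzS c h
    | zeroNorth c h => exact hzN c h
    | oneSouth c h => exact hoS c h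
    | oneNorth c h => exact hoN c h)

/-- The circle of the connected sum that contains, or is formed from, a circle of the second
diagram. -/
def circleRight : D₂.Circle (resRight v) → (orientedSum D₁ p₁ D₂ p₂).Circle v :=
  D₂.circleLift (resRight v) (fun e => (orientedSum D₁ p₁ D₂ p₂).circle v (Sum.inr e)) (by
    have hm : ∀ e, D₂.Marked e → e ≠ p₂.1 → (orientedSum D₁ p₁ D₂ p₂).circle v (Sum.inr e) =
        (orientedSum D₁ p₁ D₂ p₂).circle v (Sum.inr (D₂.next e)) := by
      intro e he hne
      have := KnotDiagram.circle_eq_of_joined _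
        (.marked (v := v) _ ((marked_inr D₁ p₁ D₂ p₂).2 he))
      rwa [next_inr_of_ne _ _ _ _ hne] at this
    have hzS := fun c h => (orientedSum D₁ p₁ D₂ p₂).circle_eq_of_joined
      (.zeroSouth (v := v) (Sum.inr c) h)
    have hzN := fun c h => (orientedSum D₁ p₁ D₂ p₂).circle_eq_of_joined
      (.zeroNorth (v := v) (Sum.inr c) h)
    have hoS := fun c h => (orientedSum D₁ p₁ D₂ p₂).circle_eq_of_joined
      (.oneSouth (v := v) (Sum.inr c) h)
    have hoN := fun c h => (orientedSum D₁ p₁ D₂ p₂).circle_eq_of_joined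
      (.oneNorth (v := v) (Sum.inr c) h)
    simp only [next_lower_inr, east_inr, west_inr] at hzS hzN hoS hoN
    intro e e' h
    cases h with
    | marked _ h =>
      by_cases hp : e = p₂.1
      · subst hp
        exact D₂.eq_next_of_cut (resRight v) _ _ h hm (fun c hc => ⟨hzS c hc, hzN c hc⟩)
          (fun c hc => ⟨hoS c hc, hoN c hc⟩)
      · exact hm e h hp
    | zeroSouth c h => exact hzS c h
    | zeroNorth c h => exact hzN c h
    | oneSouth c h => exact hoS c h
    | oneNorth c h => exact hoN c h)

theorem circleLeft_circle (e : D₁.Edge) : circleLeft v (D₁.circle (resLeft v) e) =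
    (orientedSum D₁ p₁ D₂ p₂).circle v (Sum.inl e) := rfl

theorem circleRight_circle (e : D₂.Edge) : circleRight v (D₂.circle (resRight v) e) =
    (orientedSum D₁ p₁ D₂ p₂).circle v (Sum.inr e) := rfl

/-- The circles through the two basepoints become one circle. -/
theorem circleLeft_fixedPoint : circleLeft v (D₁.circle (resLeft v) p₁.1) =
    circleRight v (D₂.circle (resRight v) p₂.1) := by
  have h := KnotDiagram.circle_eq_of_joined _
    (.marked (v := v) _ ((marked_inl D₁ p₁ D₂ p₂).2 (D₁.marked_fixedPoint p₁)))
  have h₂ := D₂.circle_eq_of_joined (.marked (v := resRight v) _ (D₂.marked_fixedPoint p₂))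
  rw [next_inl_fixedPoint] at h
  rw [circleLeft_circle, h, h₂, circleRight_circle]

/-- The set of circles of the connected sum is the union of those of the two diagrams, glued along
the circles through the basepoints: a function on it is a pair of functions that agree there. -/
def circleDesc {T : Type} (f₁ : D₁.Circle (resLeft v) → T) (f₂ : D₂.Circle (resRight v) → T)
    (h : f₁ (D₁.circle (resLeft v) p₁.1) = f₂ (D₂.circle (resRight v) p₂.1)) :
    (orientedSum D₁ p₁ D₂ p₂).Circle v → T :=
  KnotDiagram.circleLift _ v (Sum.elim (fun e => f₁ (D₁.circle (resLeft v) e))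
    (fun e => f₂ (D₂.circle (resRight v) e))) (by
    have hn₁ := D₁.circle_eq_of_joined (.marked (v := resLeft v) _ (D₁.marked_fixedPoint p₁))
    have hn₂ := D₂.circle_eq_of_joined (.marked (v := resRight v) _ (D₂.marked_fixedPoint p₂))
    intro e e' hj
    cases hj with
    | marked _ hm =>
      rcases e with e | e
      · by_cases hp : e = p₁.1
        · subst hp
          rw [next_inl_fixedPoint, Sum.elim_inl, Sum.elim_inr, h, hn₂]
        · rw [next_inl_of_ne _ _ _ _ hp, Sum.elim_inl, Sum.elim_inl]
          exact congrArg f₁ (D₁.circle_eq_of_joined (.marked _ ((marked_inl _ _ _ _).1 hm)))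
      · by_cases hp : e = p₂.1
        · subst hp
          rw [next_inr_fixedPoint, Sum.elim_inl, Sum.elim_inr, ← h, hn₁]
        · rw [next_inr_of_ne _ _ _ _ hp, Sum.elim_inr, Sum.elim_inr]
          exact congrArg f₂ (D₂.circle_eq_of_joined (.marked _ ((marked_inr _ _ _ _).1 hm)))
    | zeroSouth c hc =>
      rcases c with c | c
      · rw [east_inl]
        exact congrArg f₁ (D₁.circle_eq_of_joined (.zeroSouth c hc))
      · rw [east_inr]
        exact congrArg f₂ (D₂.circle_eq_of_joined (.zeroSouth c hc))
    | zeroNorth c hc =>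
      rcases c with c | c
      · rw [west_inl, next_lower_inl]
        exact congrArg f₁ (D₁.circle_eq_of_joined (.zeroNorth c hc))
      · rw [west_inr, next_lower_inr]
        exact congrArg f₂ (D₂.circle_eq_of_joined (.zeroNorth c hc))
    | oneSouth c hc =>
      rcases c with c | c
      · rw [west_inl]
        exact congrArg f₁ (D₁.circle_eq_of_joined (.oneSouth c hc))
      · rw [west_inr]
        exact congrArg f₂ (D₂.circle_eq_of_joined (.oneSouth c hc))
    | oneNorth c hc =>
      rcases c with c | c
      · rw [east_inl, next_lower_inl]
        exact congrArg f₁ (D₁.circle_eq_of_joined (.oneNorth c hc))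
      · rw [east_inr, next_lower_inr]
        exact congrArg f₂ (D₂.circle_eq_of_joined (.oneNorth c hc)))

theorem circleDesc_left {T : Type} (f₁ : D₁.Circle (resLeft v) → T)
    (f₂ : D₂.Circle (resRight v) → T)
    (h : f₁ (D₁.circle (resLeft v) p₁.1) = f₂ (D₂.circle (resRight v) p₂.1))
    (z : D₁.Circle (resLeft v)) : circleDesc v f₁ f₂ h (circleLeft v z) = f₁ z := by
  induction z using Quotient.inductionOn with
  | h e => rfl

theorem circleDesc_right {T : Type} (f₁ : D₁.Circle (resLeft v) → T)
    (f₂ : D₂.Circle (resRight v) → T)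
    (h : f₁ (D₁.circle (resLeft v) p₁.1) = f₂ (D₂.circle (resRight v) p₂.1))
    (z : D₂.Circle (resRight v)) : circleDesc v f₁ f₂ h (circleRight v z) = f₂ z := by
  induction z using Quotient.inductionOn with
  | h e => rfl

theorem circle_cases {P : (orientedSum D₁ p₁ D₂ p₂).Circle v → Prop}
    (hl : ∀ z, P (circleLeft v z)) (hr : ∀ z, P (circleRight v z)) (z) : P z := by
  induction z using Quotient.inductionOn with
  | h e =>
    rcases e with e | e
    · exact hl (D₁.circle _ e)
    · exact hr (D₂.circle _ e)

/-- A retraction sends all circles of the second diagram to the circle through the basepoint. -/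
theorem circleLeft_injective : Function.Injective (circleLeft v) :=
  Function.LeftInverse.injective (g := circleDesc v id (fun _ => D₁.circle _ p₁.1) rfl)
    fun z => circleDesc_left v _ _ _ z

theorem circleRight_injective : Function.Injective (circleRight v) :=
  Function.LeftInverse.injective (g := circleDesc v (fun _ => D₂.circle _ p₂.1) id rfl)
    fun z => circleDesc_right v _ _ _ z

theorem card_circle : Nat.card ((orientedSum D₁ p₁ D₂ p₂).Circle v) + 1 =
    Nat.card (D₁.Circle (resLeft v)) + Nat.card (D₂.Circle (resRight v)) := by
  classical
  have : Finite (D₁.Circle (resLeft v)) := Quotient.finite _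
  have : Finite (D₂.Circle (resRight v)) := Quotient.finite _
  -- Represent the glued circle by its part in the first diagram, and drop its part in the second.
  let q : D₂.Circle (resRight v) := D₂.circle (resRight v) p₂.1
  let e : D₁.Circle (resLeft v) ⊕ {z : D₂.Circle (resRight v) // z ≠ q} ≃
      (orientedSum D₁ p₁ D₂ p₂).Circle v :=
    { toFun := Sum.elim (circleLeft v) (fun z => circleRight v z.1)
      invFun := circleDesc v Sum.inl
        (fun z => if h : z = q then Sum.inl (D₁.circle _ p₁.1) else Sum.inr ⟨z, h⟩) (by simp [q])
      left_inv := by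
        rintro (z | ⟨z, hz⟩)
        · exact circleDesc_left v _ _ _ z
        · rw [Sum.elim_inr, circleDesc_right, dif_neg hz]
      right_inv := by
        intro z
        induction z using circle_cases with
        | hl z => rw [circleDesc_left, Sum.elim_inl]
        | hr z =>
          rw [circleDesc_right]
          split_ifs with h
          · rw [Sum.elim_inl, circleLeft_fixedPoint, h]
          · rw [Sum.elim_inr] }
  rw [← Nat.card_congr e, Nat.card_sum, add_assoc,
    ← Nat.card_congr (Equiv.optionSubtypeNe q), Finite.card_option]

end orientedSum

end TransvergentDiagram

/-! ### Naturality of the edge maps -/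

namespace KnotDiagram

/-- Edge maps commute with relabellings of circles that come from a map `g` of edges and that match
the factors of the edge maps. -/
theorem relabel_edgeMap (D D' : KnotDiagram) (g : D.Edge → D'.Edge) {c : D.Crossing}
    {c' : D'.Crossing} {v w : D.Resolution} {v' w' : D'.Resolution}
    (hv : v = Function.update w c false) (hw : w c = true)
    (hv' : v' = Function.update w' c' false) (hw' : w' c' = true)
    (f : D.Circle v → D'.Circle v') (hf : ∀ e, f (D.circle v e) = D'.circle v' (g e))
    (h : D.Circle w → D'.Circle w') (hh : ∀ e, h (D.circle w e) = D'.circle w' (g e))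
    (hfactor : CircleAlgebra.relabel h (D.edgeFactor c w) = D'.edgeFactor c' w')
    (a : CircleAlgebra (D.Circle v)) :
    D'.edgeMap c' v' w' (CircleAlgebra.relabel f a) =
      CircleAlgebra.relabel h (D.edgeMap c v w a) := by
  rw [edgeMap_apply, edgeMap_apply, map_mul, hfactor]
  refine CircleAlgebra.mul_map_eq ((CircleAlgebra.relabel (D'.carry v' w')).comp
    (CircleAlgebra.relabel f)) ((CircleAlgebra.relabel h).comp
      (CircleAlgebra.relabel (D.carry v w))) _ (fun z => ?_) a
  induction z using Quotient.inductionOn with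
  | h e =>
    change _ * CircleAlgebra.relabel _ (CircleAlgebra.relabel f (CircleAlgebra.x (D.circle v e))) =
      _ * CircleAlgebra.relabel h
        (CircleAlgebra.relabel (D.carry v w) (CircleAlgebra.x (D.circle v e)))
    rw [CircleAlgebra.relabel_x, CircleAlgebra.relabel_x, hf, D'.edgeFactor_mul_carry hv' hw',
      ← hfactor, CircleAlgebra.relabel_x, ← map_mul, D.edgeFactor_mul_carry hv hw, map_mul,
      CircleAlgebra.relabel_x, hh]

theorem edgeMap_mul (D : KnotDiagram) {c : D.Crossing} {v w : D.Resolution}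
    {a b : CircleAlgebra (D.Circle v)} {b' : CircleAlgebra (D.Circle w)}
    (hb : D.edgeFactor c w * CircleAlgebra.relabel (D.carry v w) b = D.edgeFactor c w * b') :
    D.edgeMap c v w (a * b) = D.edgeMap c v w a * b' := by
  rw [edgeMap_apply, edgeMap_apply, map_mul, mul_left_comm, hb]
  ring

end KnotDiagram

/-! ### Reversal of the orientation -/

namespace TransvergentDiagram

section reverse

variable (D : TransvergentDiagram)

theorem reverse_east (c : D.Crossing) : D.reverse.east c = D.west c := by
  change (if D.positive c then D.next.symm (D.next (D.upper c)) else D.next (D.upper c)) = _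
  rw [Equiv.symm_apply_apply, KnotDiagram.west]

theorem reverse_west (c : D.Crossing) : D.reverse.west c = D.east c := by
  change (if D.positive c then D.next (D.upper c) else D.next.symm (D.next (D.upper c))) = _
  rw [Equiv.symm_apply_apply, KnotDiagram.east]

theorem reverse_lower (c : D.Crossing) : D.reverse.lower c = D.next (D.lower c) := rfl

theorem reverse_next_lower (c : D.Crossing) :
    D.reverse.next (D.reverse.lower c) = D.lower c :=
  Equiv.symm_apply_apply _ _

theorem reverse_marked (e : D.Edge) : D.reverse.Marked (D.next e) ↔ D.Marked e := by
  refine forall_congr' fun c => ?_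
  change D.next (D.lower c) ≠ D.next e ∧ D.next (D.upper c) ≠ D.next e ↔ _
  rw [D.next.injective.ne_iff, D.next.injective.ne_iff]

theorem circle_eq_of_reverse_joined {v : D.Resolution} {e e' : D.reverse.Edge}
    (h : D.reverse.Joined v e e') : D.circle v e = D.circle v e' := by
  cases h with
  | marked _ h =>
    obtain ⟨e, rfl⟩ := D.next.surjective e
    have h' : D.reverse.next (D.next e) = e := D.next.symm_apply_apply e
    rw [h']
    exact (D.circle_eq_of_joined (.marked _ ((D.reverse_marked e).1 h))).symm
  | zeroSouth c h =>
    exact (D.circle_eq_of_joined (.zeroNorth (D := D.toKnotDiagram) c h)).trans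
      (congrArg (D.circle v) (D.reverse_east c).symm)
  | zeroNorth c h =>
    exact (congrArg (D.circle v) (D.reverse_next_lower c)).trans
      ((D.circle_eq_of_joined (.zeroSouth (D := D.toKnotDiagram) c h)).trans
        (congrArg (D.circle v) (D.reverse_west c).symm))
  | oneSouth c h =>
    exact (D.circle_eq_of_joined (.oneNorth (D := D.toKnotDiagram) c h)).trans
      (congrArg (D.circle v) (D.reverse_west c).symm)
  | oneNorth c h =>
    exact (congrArg (D.circle v) (D.reverse_next_lower c)).trans
      ((D.circle_eq_of_joined (.oneSouth (D := D.toKnotDiagram) c h)).trans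
        (congrArg (D.circle v) (D.reverse_east c).symm))

theorem reverse_circle_eq_of_joined {v : D.Resolution} {e e' : D.Edge}
    (h : D.Joined v e e') : D.reverse.circle v e = D.reverse.circle v e' := by
  cases h with
  | marked _ h =>
    have h' := D.reverse.circle_eq_of_joined
      (.marked (D := D.reverse.toKnotDiagram) (v := v) _ ((D.reverse_marked e).2 h))
    have h'' : D.reverse.next (D.next e) = e := D.next.symm_apply_apply e
    rw [h''] at h'
    exact h'.symm
  | zeroSouth c h =>
    rw [← reverse_west, ← reverse_next_lower]
    exact D.reverse.circle_eq_of_joined (.zeroNorth (D := D.reverse.toKnotDiagram) c h)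
  | zeroNorth c h =>
    rw [← reverse_east]
    exact D.reverse.circle_eq_of_joined (.zeroSouth (D := D.reverse.toKnotDiagram) c h)
  | oneSouth c h =>
    rw [← reverse_east, ← reverse_next_lower]
    exact D.reverse.circle_eq_of_joined (.oneNorth (D := D.reverse.toKnotDiagram) c h)
  | oneNorth c h =>
    rw [← reverse_west]
    exact D.reverse.circle_eq_of_joined (.oneSouth (D := D.reverse.toKnotDiagram) c h)

/-- Reversal of the orientation does not change the circles. -/
def reverseCircle (v : D.Resolution) : D.reverse.Circle v ≃ D.Circle v where
  toFun := D.reverse.circleLift v (D.circle v) fun _ _ => D.circle_eq_of_reverse_joined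
  invFun := D.circleLift v (D.reverse.circle v) fun _ _ => D.reverse_circle_eq_of_joined
  left_inv z := by
    induction z using Quotient.inductionOn with
    | h e => rfl
  right_inv z := by
    induction z using Quotient.inductionOn with
    | h e => rfl

theorem reverseCircle_circle (v : D.Resolution) (e : D.Edge) :
    D.reverseCircle v (D.reverse.circle v e) = D.circle v e := rfl

theorem reverse_edgeFactor (c : D.Crossing) (w : D.Resolution) :
    CircleAlgebra.relabel (D.reverseCircle w) (D.reverse.edgeFactor c w) = D.edgeFactor c w := by
  have hiff : D.reverse.circle w (D.next (D.lower c)) = D.reverse.circle w (D.lower c) ↔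
      D.circle w (D.lower c) = D.circle w (D.next (D.lower c)) := by
    rw [← (D.reverseCircle w).injective.eq_iff, reverseCircle_circle, reverseCircle_circle,
      eq_comm]
  unfold KnotDiagram.edgeFactor
  rw [reverse_next_lower, reverse_lower]
  by_cases h : D.circle w (D.lower c) = D.circle w (D.next (D.lower c))
  · rw [if_pos (hiff.2 h), if_pos h, map_one]
  · rw [if_neg (mt hiff.1 h), if_neg h, map_add, map_add, CircleAlgebra.relabel_x,
      CircleAlgebra.relabel_x, reverseCircle_circle, reverseCircle_circle, CircleAlgebra.u,
      AlgHom.commutes, CircleAlgebra.u, add_comm (CircleAlgebra.x _)]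

/-- The identification of the complexes of a diagram and of its reverse. -/
noncomputable def reverseChain : D.reverse.Chain →ₗ[BNRing] D.Chain :=
  LinearMap.pi fun v => (CircleAlgebra.relabel (D.reverseCircle v)).toLinearMap ∘ₗ
    LinearMap.proj (φ := fun v => CircleAlgebra (D.reverse.Circle v)) v

theorem reverseChain_apply (a : D.reverse.Chain) (v : D.Resolution) :
    D.reverseChain a v = CircleAlgebra.relabel (D.reverseCircle v) (a v) := rfl

theorem reverseChain_differential (a : D.reverse.Chain) :
    D.reverseChain (D.reverse.differential a) = D.differential (D.reverseChain a) := by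
  funext w
  rw [reverseChain_apply, KnotDiagram.differential_apply]
  refine (congrArg _ (D.reverse.differential_apply a w)).trans ((map_sum _ _ _).trans ?_)
  refine Finset.sum_congr rfl fun c _ => ?_
  rw [apply_ite (CircleAlgebra.relabel (D.reverseCircle w)), map_zero]
  split_ifs with hw
  · exact (KnotDiagram.relabel_edgeMap D.reverse.toKnotDiagram D.toKnotDiagram id rfl hw rfl hw _
      (D.reverseCircle_circle _) _ (D.reverseCircle_circle _) (D.reverse_edgeFactor c w) _).symm
  · rfl

theorem reverseChain_tau (a : D.reverse.Chain) :
    D.reverseChain (D.reverse.tau a) = D.tau (D.reverseChain a) := by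
  funext w
  change CircleAlgebra.relabel _ (CircleAlgebra.relabel _ _) =
    CircleAlgebra.relabel _ (CircleAlgebra.relabel _ _)
  rw [CircleAlgebra.relabel_relabel, CircleAlgebra.relabel_relabel]
  congr 2
  funext z
  induction z using Quotient.inductionOn with
  | h e => rfl

theorem reverse_grOne (v : D.Resolution) : D.reverse.grOne v = D.grOne v := by
  unfold KnotDiagram.grOne
  rw [Nat.card_congr (D.reverseCircle v)]
  rfl

theorem reverseChain_single (v : D.Resolution) (a : CircleAlgebra (D.reverse.Circle v)) :
    D.reverseChain (Pi.single v a) = Pi.single v (CircleAlgebra.relabel (D.reverseCircle v) a) := by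
  funext w
  exact Pi.apply_single (fun v => CircleAlgebra.relabel (D.reverseCircle v))
    (fun v => map_zero (CircleAlgebra.relabel (D.reverseCircle v))) v a w

/-- The inverse of `reverseChain`. -/
noncomputable def reverseChainInv : D.Chain →ₗ[BNRing] D.reverse.Chain :=
  LinearMap.pi fun v => (CircleAlgebra.relabel (D.reverseCircle v).symm).toLinearMap ∘ₗ
    LinearMap.proj (φ := fun v => CircleAlgebra (D.Circle v)) v

theorem reverseChainInv_single (v : D.Resolution) (a : CircleAlgebra (D.Circle v)) :
    D.reverseChainInv (Pi.single v a) =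
      Pi.single v (CircleAlgebra.relabel (D.reverseCircle v).symm a) := by
  funext w
  exact Pi.apply_single (fun v => CircleAlgebra.relabel (D.reverseCircle v).symm)
    (fun v => map_zero (CircleAlgebra.relabel (D.reverseCircle v).symm)) v a w

theorem reverseChainInv_reverseChain (a : D.reverse.Chain) :
    D.reverseChainInv (D.reverseChain a) = a := by
  funext v
  change CircleAlgebra.relabel _ (CircleAlgebra.relabel _ _) = _
  rw [CircleAlgebra.relabel_relabel, Equiv.symm_comp_self, CircleAlgebra.relabel_id]
  rfl

theorem reverseChain_reverseChainInv (a : D.Chain) :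
    D.reverseChain (D.reverseChainInv a) = a := by
  funext v
  change CircleAlgebra.relabel _ (CircleAlgebra.relabel _ _) = _
  rw [CircleAlgebra.relabel_relabel, Equiv.self_comp_symm, CircleAlgebra.relabel_id]
  rfl

/-- The unpointed reduced complex does not depend on the orientation of the knot. -/
noncomputable def reverseIso :
    InvolutiveComplex.EquivariantIso (D.reverse.reduced .unpointed) (D.reduced .unpointed) where
  toLinearEquiv :=
    { toFun := fun a => (⟨D.reverseChain a.1, fun v _ =>
        CircleAlgebra.relabel_mem_unpointed _ (a.2 v (Set.mem_univ v))⟩ : D.unpointedReduced)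
      map_add' := fun a b => Subtype.ext (map_add D.reverseChain a.1 b.1)
      map_smul' := fun r a => Subtype.ext (map_smul D.reverseChain r a.1)
      invFun := fun a => (⟨D.reverseChainInv a.1, fun v _ =>
        CircleAlgebra.relabel_mem_unpointed _ (a.2 v (Set.mem_univ v))⟩ :
          D.reverse.unpointedReduced)
      left_inv := fun a => Subtype.ext (D.reverseChainInv_reverseChain a.1)
      right_inv := fun a => Subtype.ext (D.reverseChain_reverseChainInv a.1) }
  map_d a := Subtype.ext (D.reverseChain_differential a.1)
  map_tau a := Subtype.ext (D.reverseChain_tau a.1)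
  map_homogeneous i j a := by
    change D.reverseChain a.1 ∈ D.homogeneous i (j + 1) ↔ a.1 ∈ D.reverse.homogeneous i (j + 1)
    constructor
    · intro h
      have h' := D.map_mem_of_mem_homogeneous D.reverseChainInv
        (D.reverse.homogeneous i (j + 1)) (fun v n b hi hj hb => by
          rw [reverseChainInv_single]
          exact D.reverse.single_mem_homogeneous hi (by rw [reverse_grOne, hj])
            (CircleAlgebra.relabel_mem_homogeneous _ hb)) h
      change D.reverseChainInv (D.reverseChain a.1) ∈ _ at h'
      rwa [reverseChainInv_reverseChain] at h'
    · intro h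
      exact D.reverse.map_mem_of_mem_homogeneous D.reverseChain
        (D.homogeneous i (j + 1)) (fun v n b hi hj hb => by
          refine (D.reverseChain_single v b) ▸ ?_
          exact D.single_mem_homogeneous hi ((D.reverse_grOne v) ▸ hj)
            (CircleAlgebra.relabel_mem_homogeneous _ hb)) h

end reverse

end TransvergentDiagram

/-! ### The unpointed subalgebra of a connected sum -/

namespace CircleAlgebra

/-- The unpointed subalgebra, as an algebra in its own right. It is a separate type in order that
the instances on its tensor products are found by their ring structure, and not by that of a
submodule. -/
def UnpointedAlgebra (Z : Type) : Type := unpointed Z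

noncomputable instance (Z : Type) : CommRing (UnpointedAlgebra Z) :=
  inferInstanceAs (CommRing (unpointed Z))

noncomputable instance (Z : Type) : Algebra BNRing (UnpointedAlgebra Z) :=
  inferInstanceAs (Algebra BNRing (unpointed Z))

/-- The inclusion of the unpointed subalgebra. -/
noncomputable def UnpointedAlgebra.val (Z : Type) : UnpointedAlgebra Z →ₐ[BNRing] CircleAlgebra Z :=
  (unpointed Z).val

theorem UnpointedAlgebra.val_mem {Z : Type} (a : UnpointedAlgebra Z) :
    UnpointedAlgebra.val Z a ∈ unpointed Z := a.2

/-- The projection `x_c ↦ x_c + x_p` onto the unpointed subalgebra. -/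
noncomputable def toUnpointed {Z : Type} (p : Z) : CircleAlgebra Z →ₐ[BNRing] UnpointedAlgebra Z :=
  (shear p).codRestrict (unpointed Z) (shear_mem_unpointed p)

theorem toUnpointed_val {Z : Type} (p : Z) (a : UnpointedAlgebra Z) :
    toUnpointed p (UnpointedAlgebra.val Z a) = a :=
  Subtype.ext (shear_of_mem_unpointed p a.2)

theorem toUnpointed_self {Z : Type} (p : Z) : toUnpointed p (x p) = 0 :=
  Subtype.ext ((shear_x p p).trans (two_mul_eq_zero (x p)))

/-- The grading by monomial degree on the tensor product of two unpointed subalgebras. -/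
noncomputable def tensorHomogeneous (Z Z' : Type) (n : ℤ) :
    AddSubgroup (UnpointedAlgebra Z ⊗[BNRing] UnpointedAlgebra Z') :=
  AddSubgroup.closure {t | ∃ (m k : ℤ) (a : UnpointedAlgebra Z) (b : UnpointedAlgebra Z'),
    m + k = n ∧ UnpointedAlgebra.val Z a ∈ homogeneous Z m ∧
      UnpointedAlgebra.val Z' b ∈ homogeneous Z' k ∧ t = a ⊗ₜ[BNRing] b}

instance (Z Z' : Type) : SetLike.GradedMonoid (tensorHomogeneous Z Z') where
  one_mem := AddSubgroup.subset_closure ⟨0, 0, 1, 1, by simp, one_mem_homogeneous Z,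
    one_mem_homogeneous Z', rfl⟩
  mul_mem m n s t hs ht := by
    induction hs using AddSubgroup.closure_induction with
    | zero => rw [zero_mul]; exact zero_mem _
    | add s s' _ _ h h' => rw [add_mul]; exact add_mem h h'
    | neg s _ h => rw [neg_mul]; exact neg_mem h
    | mem s hs =>
      induction ht using AddSubgroup.closure_induction with
      | zero => rw [mul_zero]; exact zero_mem _
      | add t t' _ _ h h' => rw [mul_add]; exact add_mem h h'
      | neg t _ h => rw [mul_neg]; exact neg_mem h
      | mem t ht =>
        obtain ⟨m₁, k₁, a₁, b₁, rfl, ha₁, hb₁, rfl⟩ := hs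
        obtain ⟨m₂, k₂, a₂, b₂, rfl, ha₂, hb₂, rfl⟩ := ht
        refine AddSubgroup.subset_closure ⟨m₁ + m₂, k₁ + k₂, a₁ * a₂, b₁ * b₂, by ring,
          mul_mem_homogeneous ha₁ ha₂, mul_mem_homogeneous hb₁ hb₂, ?_⟩
        rw [Algebra.TensorProduct.tmul_mul_tmul]

theorem tmul_mem_tensorHomogeneous {Z Z' : Type} {m k n : ℤ} (h : m + k = n)
    {a : UnpointedAlgebra Z} {b : UnpointedAlgebra Z'}
    (ha : UnpointedAlgebra.val Z a ∈ homogeneous Z m)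
    (hb : UnpointedAlgebra.val Z' b ∈ homogeneous Z' k) :
    a ⊗ₜ[BNRing] b ∈ tensorHomogeneous Z Z' n :=
  AddSubgroup.subset_closure ⟨m, k, a, b, h, ha, hb, rfl⟩

theorem u_mem_tensorHomogeneous (Z Z' : Type) :
    algebraMap BNRing (UnpointedAlgebra Z ⊗[BNRing] UnpointedAlgebra Z') BNRing.u ∈
      tensorHomogeneous Z Z' 1 :=
  tmul_mem_tensorHomogeneous (add_zero 1)
    (a := algebraMap BNRing (UnpointedAlgebra Z) BNRing.u) (b := 1)
    (u_mem_homogeneous Z) (one_mem_homogeneous Z')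

theorem shear_x_mem_homogeneous {Z : Type} (p c : Z) : shear p (x c) ∈ homogeneous Z 1 := by
  rw [shear_x]
  exact add_mem (x_mem_homogeneous c) (x_mem_homogeneous p)

end CircleAlgebra

namespace TransvergentDiagram

variable {D₁ : TransvergentDiagram} {p₁ : D₁.FixedPoint} {D₂ : TransvergentDiagram}
  {p₂ : D₂.FixedPoint}

section resolution

variable (v : (orientedSum D₁ p₁ D₂ p₂).Resolution)

/-- The product of the images of the unpointed subalgebras of the two diagrams in the algebra of the
connected sum. -/
noncomputable def joinCircles : CircleAlgebra.UnpointedAlgebra (D₁.Circle (resLeft v)) ⊗[BNRing]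
      CircleAlgebra.UnpointedAlgebra (D₂.Circle (resRight v)) →ₐ[BNRing]
    CircleAlgebra ((orientedSum D₁ p₁ D₂ p₂).Circle v) :=
  Algebra.TensorProduct.productMap
    ((CircleAlgebra.relabel (circleLeft v)).comp (CircleAlgebra.UnpointedAlgebra.val _))
    ((CircleAlgebra.relabel (circleRight v)).comp (CircleAlgebra.UnpointedAlgebra.val _))

theorem joinCircles_tmul (a : CircleAlgebra.UnpointedAlgebra (D₁.Circle (resLeft v)))
    (b : CircleAlgebra.UnpointedAlgebra (D₂.Circle (resRight v))) :
    joinCircles v (a ⊗ₜ b) =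
      CircleAlgebra.relabel (circleLeft v) (CircleAlgebra.UnpointedAlgebra.val _ a) *
        CircleAlgebra.relabel (circleRight v) (CircleAlgebra.UnpointedAlgebra.val _ b) :=
  Algebra.TensorProduct.productMap_apply_tmul _ _ _ _

/-- The values of `cutCircles` on the generators. -/
noncomputable def cutCircle : (orientedSum D₁ p₁ D₂ p₂).Circle v →
    CircleAlgebra.UnpointedAlgebra (D₁.Circle (resLeft v)) ⊗[BNRing]
      CircleAlgebra.UnpointedAlgebra (D₂.Circle (resRight v)) :=
  circleDesc v
    (fun z => CircleAlgebra.toUnpointed (D₁.circle _ p₁.1) (CircleAlgebra.x z) ⊗ₜ 1)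
    (fun z => 1 ⊗ₜ CircleAlgebra.toUnpointed (D₂.circle _ p₂.1) (CircleAlgebra.x z)) (by
      rw [CircleAlgebra.toUnpointed_self, CircleAlgebra.toUnpointed_self,
        TensorProduct.zero_tmul, TensorProduct.tmul_zero])

theorem cutCircle_left (z : D₁.Circle (resLeft v)) : cutCircle v (circleLeft v z) =
    CircleAlgebra.toUnpointed (D₁.circle _ p₁.1) (CircleAlgebra.x z) ⊗ₜ 1 :=
  circleDesc_left v _ _ _ z

theorem cutCircle_right (z : D₂.Circle (resRight v)) : cutCircle v (circleRight v z) =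
    1 ⊗ₜ CircleAlgebra.toUnpointed (D₂.circle _ p₂.1) (CircleAlgebra.x z) :=
  circleDesc_right v _ _ _ z

/-- The algebra map that sends `x_c` to `(x_c + x_{c_{p₁}}) ⊗ 1` or `1 ⊗ (x_c + x_{c_{p₂}})`,
depending on the diagram that `c` comes from. On the circle through the basepoints, both
are zero. -/
noncomputable def cutCircles : CircleAlgebra ((orientedSum D₁ p₁ D₂ p₂).Circle v) →ₐ[BNRing]
    CircleAlgebra.UnpointedAlgebra (D₁.Circle (resLeft v)) ⊗[BNRing]
      CircleAlgebra.UnpointedAlgebra (D₂.Circle (resRight v)) :=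
  CircleAlgebra.lift (cutCircle v) fun z => by
    induction z using circle_cases with
    | hl z =>
      rw [cutCircle_left, Algebra.TensorProduct.tmul_mul_tmul, one_mul, ← map_mul,
        CircleAlgebra.x_sq, map_mul, CircleAlgebra.u, AlgHom.commutes,
        Algebra.TensorProduct.algebraMap_apply, Algebra.TensorProduct.tmul_mul_tmul, one_mul]
    | hr z =>
      rw [cutCircle_right, Algebra.TensorProduct.tmul_mul_tmul, one_mul, ← map_mul,
        CircleAlgebra.x_sq, map_mul, CircleAlgebra.u, AlgHom.commutes,
        Algebra.TensorProduct.algebraMap_apply', Algebra.TensorProduct.tmul_mul_tmul, one_mul]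

theorem cutCircles_joinCircles (t : CircleAlgebra.UnpointedAlgebra (D₁.Circle (resLeft v)) ⊗[BNRing]
      CircleAlgebra.UnpointedAlgebra (D₂.Circle (resRight v))) :
    cutCircles v (joinCircles v t) = t := by
  have hl : ∀ a, cutCircles v (CircleAlgebra.relabel (circleLeft v) a) =
      CircleAlgebra.toUnpointed (D₁.circle _ p₁.1) a ⊗ₜ 1 :=
    DFunLike.congr_fun (CircleAlgebra.hom_ext
      (f := (cutCircles v).comp (CircleAlgebra.relabel (circleLeft v)))
      (g := AlgHom.comp (Algebra.TensorProduct.includeLeft (S := BNRing))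
        (CircleAlgebra.toUnpointed (D₁.circle _ p₁.1))) fun z => by
      rw [AlgHom.comp_apply, CircleAlgebra.relabel_x, cutCircles, CircleAlgebra.lift_x,
        cutCircle_left]
      rfl)
  have hr : ∀ b, cutCircles v (CircleAlgebra.relabel (circleRight v) b) =
      1 ⊗ₜ CircleAlgebra.toUnpointed (D₂.circle _ p₂.1) b :=
    DFunLike.congr_fun (CircleAlgebra.hom_ext
      (f := (cutCircles v).comp (CircleAlgebra.relabel (circleRight v)))
      (g := AlgHom.comp Algebra.TensorProduct.includeRight
        (CircleAlgebra.toUnpointed (D₂.circle _ p₂.1))) fun z => by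
      rw [AlgHom.comp_apply, CircleAlgebra.relabel_x, cutCircles, CircleAlgebra.lift_x,
        cutCircle_right]
      rfl)
  induction t using TensorProduct.induction_on with
  | zero => rw [map_zero, map_zero]
  | add s t hs ht => rw [map_add, map_add, hs, ht]
  | tmul a b =>
    rw [joinCircles_tmul, map_mul, hl, hr, CircleAlgebra.toUnpointed_val,
      CircleAlgebra.toUnpointed_val, Algebra.TensorProduct.tmul_mul_tmul, one_mul, mul_one]

/-- On all of the circle algebra the composite is the projection `shear` onto the unpointed
subalgebra, for the circle through the basepoints. -/
theorem joinCircles_cutCircles {a : CircleAlgebra ((orientedSum D₁ p₁ D₂ p₂).Circle v)}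
    (ha : a ∈ CircleAlgebra.unpointed _) : joinCircles v (cutCircles v a) = a := by
  have h : (joinCircles v).comp (cutCircles v) =
      CircleAlgebra.shear (circleLeft v (D₁.circle _ p₁.1)) :=
    CircleAlgebra.hom_ext fun z => by
      rw [AlgHom.comp_apply, cutCircles, CircleAlgebra.lift_x, CircleAlgebra.shear_x]
      induction z using circle_cases with
      | hl z =>
        rw [cutCircle_left, joinCircles_tmul]
        change CircleAlgebra.relabel _ (CircleAlgebra.shear _ (CircleAlgebra.x z)) *
          CircleAlgebra.relabel _ 1 = _
        rw [CircleAlgebra.shear_x, map_one, mul_one, map_add, CircleAlgebra.relabel_x,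
          CircleAlgebra.relabel_x]
      | hr z =>
        rw [cutCircle_right, joinCircles_tmul]
        change CircleAlgebra.relabel _ 1 *
          CircleAlgebra.relabel _ (CircleAlgebra.shear _ (CircleAlgebra.x z)) = _
        rw [CircleAlgebra.shear_x, map_one, one_mul, map_add, CircleAlgebra.relabel_x,
          CircleAlgebra.relabel_x, circleLeft_fixedPoint]
  rw [← AlgHom.comp_apply, h, CircleAlgebra.shear_of_mem_unpointed _ ha]

theorem cutCircles_mem_homogeneous {n : ℤ}
    {a : CircleAlgebra ((orientedSum D₁ p₁ D₂ p₂).Circle v)}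
    (ha : a ∈ CircleAlgebra.homogeneous _ n) :
    cutCircles v a ∈ CircleAlgebra.tensorHomogeneous _ _ n := by
  refine CircleAlgebra.map_homogeneous (CircleAlgebra.tensorHomogeneous _ _)
    (CircleAlgebra.u_mem_tensorHomogeneous _ _) _ (fun z => ?_) ha
  rw [cutCircles, CircleAlgebra.lift_x]
  induction z using circle_cases with
  | hl z =>
    rw [cutCircle_left]
    exact CircleAlgebra.tmul_mem_tensorHomogeneous (add_zero 1)
      (CircleAlgebra.shear_x_mem_homogeneous _ z) (CircleAlgebra.one_mem_homogeneous _)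
  | hr z =>
    rw [cutCircle_right]
    exact CircleAlgebra.tmul_mem_tensorHomogeneous (zero_add 1)
      (CircleAlgebra.one_mem_homogeneous _) (CircleAlgebra.shear_x_mem_homogeneous _ z)

end resolution

/-! ### The complex of a connected sum -/

/-- The product of chains of the two diagrams, as a chain of the connected sum. -/
noncomputable def mulChain (D₁ : TransvergentDiagram) (p₁ : D₁.FixedPoint)
    (D₂ : TransvergentDiagram) (p₂ : D₂.FixedPoint) :
    D₁.Chain →ₗ[BNRing] D₂.Chain →ₗ[BNRing] (orientedSum D₁ p₁ D₂ p₂).Chain :=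
  LinearMap.mk₂ BNRing
    (fun a b v => CircleAlgebra.relabel (circleLeft v) (a (resLeft v)) *
      CircleAlgebra.relabel (circleRight v) (b (resRight v)))
    (fun a a' b => funext fun v => by
      rw [Pi.add_apply, map_add, add_mul]
      rfl)
    (fun r a b => funext fun v => by
      rw [Pi.smul_apply, map_smul, smul_mul_assoc]
      rfl)
    (fun a b b' => funext fun v => by
      rw [Pi.add_apply, map_add, mul_add]
      rfl)
    (fun r a b => funext fun v => by
      rw [Pi.smul_apply, map_smul, mul_smul_comm]
      rfl)

theorem mulChain_apply (a : D₁.Chain) (b : D₂.Chain)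
    (v : (orientedSum D₁ p₁ D₂ p₂).Resolution) : mulChain D₁ p₁ D₂ p₂ a b v =
      CircleAlgebra.relabel (circleLeft v) (a (resLeft v)) *
        CircleAlgebra.relabel (circleRight v) (b (resRight v)) := rfl

theorem res_ext {v w : (orientedSum D₁ p₁ D₂ p₂).Resolution} (hl : resLeft v = resLeft w)
    (hr : resRight v = resRight w) : v = w := by
  funext c
  rcases c with c | c
  · exact congrFun hl c
  · exact congrFun hr c

theorem mulChain_single (v : (orientedSum D₁ p₁ D₂ p₂).Resolution)
    (a : CircleAlgebra (D₁.Circle (resLeft v))) (b : CircleAlgebra (D₂.Circle (resRight v))) :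
    mulChain D₁ p₁ D₂ p₂ (Pi.single (resLeft v) a) (Pi.single (resRight v) b) =
      Pi.single v (CircleAlgebra.relabel (circleLeft v) a *
        CircleAlgebra.relabel (circleRight v) b) := by
  funext w
  rw [mulChain_apply]
  by_cases hw : w = v
  · subst hw
    rw [Pi.single_eq_same, Pi.single_eq_same, Pi.single_eq_same]
  · rw [Pi.single_eq_of_ne hw]
    by_cases hl : resLeft w = resLeft v
    · have hr : resRight w ≠ resRight v := fun hr => hw (res_ext hl hr)
      rw [Pi.single_eq_of_ne hr, map_zero, mul_zero]
    · rw [Pi.single_eq_of_ne hl, map_zero, zero_mul]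

theorem mulChain_tau (a : D₁.Chain) (b : D₂.Chain) :
    mulChain D₁ p₁ D₂ p₂ (D₁.tau a) (D₂.tau b) =
      (orientedSum D₁ p₁ D₂ p₂).tau (mulChain D₁ p₁ D₂ p₂ a b) := by
  funext w
  have hl : circleLeft w ∘ D₁.tauCircle (resLeft w) =
      (orientedSum D₁ p₁ D₂ p₂).tauCircle w ∘
        circleLeft ((orientedSum D₁ p₁ D₂ p₂).tauR w) := by
    funext z
    induction z using Quotient.inductionOn with
    | h e => rfl
  have hr : circleRight w ∘ D₂.tauCircle (resRight w) =
      (orientedSum D₁ p₁ D₂ p₂).tauCircle w ∘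
        circleRight ((orientedSum D₁ p₁ D₂ p₂).tauR w) := by
    funext z
    induction z using Quotient.inductionOn with
    | h e => rfl
  have hL := (CircleAlgebra.relabel_relabel (D₁.tauCircle (resLeft w)) (circleLeft w)
    (a (D₁.tauR (resLeft w)))).trans (congrArg (fun f => CircleAlgebra.relabel f _) hl)
  have hR := (CircleAlgebra.relabel_relabel (D₂.tauCircle (resRight w)) (circleRight w)
    (b (D₂.tauR (resRight w)))).trans (congrArg (fun f => CircleAlgebra.relabel f _) hr)
  change CircleAlgebra.relabel (circleLeft w)
      (CircleAlgebra.relabel (D₁.tauCircle (resLeft w)) (a (D₁.tauR (resLeft w)))) *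
    CircleAlgebra.relabel (circleRight w)
      (CircleAlgebra.relabel (D₂.tauCircle (resRight w)) (b (D₂.tauR (resRight w)))) =
    CircleAlgebra.relabel _ (mulChain D₁ p₁ D₂ p₂ a b _)
  rw [hL, hR, mulChain_apply, map_mul, CircleAlgebra.relabel_relabel,
    CircleAlgebra.relabel_relabel]
  rfl

section differential

variable (v : (orientedSum D₁ p₁ D₂ p₂).Resolution)

/-- The resolution `resLeft v` may be replaced by an equal one `r` in a value of a chain. -/
theorem exists_relabel_circleLeft (a : D₁.Chain) {r : D₁.Resolution} (hr : resLeft v = r) :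
    ∃ f : D₁.Circle r → (orientedSum D₁ p₁ D₂ p₂).Circle v,
      (∀ e, f (D₁.circle r e) = (orientedSum D₁ p₁ D₂ p₂).circle v (Sum.inl e)) ∧
      CircleAlgebra.relabel (circleLeft v) (a (resLeft v)) = CircleAlgebra.relabel f (a r) := by
  subst hr
  exact ⟨circleLeft v, circleLeft_circle v, rfl⟩

/-- The resolution `resRight v` may be replaced by an equal one `r` in a value of a chain. -/
theorem exists_relabel_circleRight (b : D₂.Chain) {r : D₂.Resolution} (hr : resRight v = r) :
    ∃ f : D₂.Circle r → (orientedSum D₁ p₁ D₂ p₂).Circle v,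
      (∀ e, f (D₂.circle r e) = (orientedSum D₁ p₁ D₂ p₂).circle v (Sum.inr e)) ∧
      CircleAlgebra.relabel (circleRight v) (b (resRight v)) = CircleAlgebra.relabel f (b r) := by
  subst hr
  exact ⟨circleRight v, circleRight_circle v, rfl⟩

theorem relabel_circleLeft_edgeFactor (c : D₁.Crossing) :
    CircleAlgebra.relabel (circleLeft v) (D₁.edgeFactor c (resLeft v)) =
      (orientedSum D₁ p₁ D₂ p₂).edgeFactor (Sum.inl c) v :=
  KnotDiagram.relabel_edgeFactor _ _ (circleLeft_injective v) rfl
    (congrArg (KnotDiagram.circle _ v) (next_lower_inl _ _ _ _ c).symm)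

theorem relabel_circleRight_edgeFactor (c : D₂.Crossing) :
    CircleAlgebra.relabel (circleRight v) (D₂.edgeFactor c (resRight v)) =
      (orientedSum D₁ p₁ D₂ p₂).edgeFactor (Sum.inr c) v :=
  KnotDiagram.relabel_edgeFactor _ _ (circleRight_injective v) rfl
    (congrArg (KnotDiagram.circle _ v) (next_lower_inr _ _ _ _ c).symm)

/-- The edge maps at crossings of the first diagram act on the first factor. -/
theorem edgeMap_inl_mulChain (a : D₁.Chain) (b : D₂.Chain) {c : D₁.Crossing}
    {v w : (orientedSum D₁ p₁ D₂ p₂).Resolution} (hv : v = Function.update w (Sum.inl c) false)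
    (hw : w (Sum.inl c) = true) :
    (orientedSum D₁ p₁ D₂ p₂).edgeMap (Sum.inl c) v w (mulChain D₁ p₁ D₂ p₂ a b v) =
      CircleAlgebra.relabel (circleLeft w)
          (D₁.edgeMap c (Function.update (resLeft w) c false) (resLeft w)
            (a (Function.update (resLeft w) c false))) *
        CircleAlgebra.relabel (circleRight w) (b (resRight w)) := by
  have hl : resLeft v = Function.update (resLeft w) c false := by
    subst hv
    funext d
    by_cases hd : d = c
    · subst hd
      rw [Function.update_self]
      exact Function.update_self _ _ _
    · rw [Function.update_of_ne hd]
      exact Function.update_of_ne (fun h => hd (Sum.inl.inj h)) _ _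
  have hr : resRight v = resRight w := by
    subst hv
    funext d
    exact Function.update_of_ne Sum.inr_ne_inl _ _
  obtain ⟨f, hf, hfa⟩ := exists_relabel_circleLeft v a hl
  obtain ⟨g, hg, hgb⟩ := exists_relabel_circleRight v b hr
  rw [mulChain_apply, hfa, hgb]
  have hb := CircleAlgebra.mul_map_eq
    ((CircleAlgebra.relabel ((orientedSum D₁ p₁ D₂ p₂).carry v w)).comp (CircleAlgebra.relabel g))
    (CircleAlgebra.relabel (circleRight w))
    ((orientedSum D₁ p₁ D₂ p₂).edgeFactor (Sum.inl c) w) (fun z => by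
      induction z using Quotient.inductionOn with
      | h e =>
        have h := KnotDiagram.edgeFactor_mul_carry _ hv hw (Sum.inr e)
        rw [← hg, ← circleRight_circle] at h
        rw [AlgHom.comp_apply, CircleAlgebra.relabel_x, CircleAlgebra.relabel_x,
          CircleAlgebra.relabel_x]
        exact h) (b (resRight w))
  rw [AlgHom.comp_apply] at hb
  have ha := KnotDiagram.relabel_edgeMap _ (orientedSum D₁ p₁ D₂ p₂).toKnotDiagram Sum.inl
    rfl hw hv hw f hf (circleLeft w) (circleLeft_circle w) (relabel_circleLeft_edgeFactor w c)
    (a (Function.update (resLeft w) c false))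
  exact (KnotDiagram.edgeMap_mul _ hb).trans (congrArg (· * _) ha)

/-- The edge maps at crossings of the second diagram act on the second factor. -/
theorem edgeMap_inr_mulChain (a : D₁.Chain) (b : D₂.Chain) {c : D₂.Crossing}
    {v w : (orientedSum D₁ p₁ D₂ p₂).Resolution} (hv : v = Function.update w (Sum.inr c) false)
    (hw : w (Sum.inr c) = true) :
    (orientedSum D₁ p₁ D₂ p₂).edgeMap (Sum.inr c) v w (mulChain D₁ p₁ D₂ p₂ a b v) =
      CircleAlgebra.relabel (circleLeft w) (a (resLeft w)) *
        CircleAlgebra.relabel (circleRight w)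
          (D₂.edgeMap c (Function.update (resRight w) c false) (resRight w)
            (b (Function.update (resRight w) c false))) := by
  have hr : resRight v = Function.update (resRight w) c false := by
    subst hv
    funext d
    by_cases hd : d = c
    · subst hd
      rw [Function.update_self]
      exact Function.update_self _ _ _
    · rw [Function.update_of_ne hd]
      exact Function.update_of_ne (fun h => hd (Sum.inr.inj h)) _ _
  have hl : resLeft v = resLeft w := by
    subst hv
    funext d
    exact Function.update_of_ne Sum.inl_ne_inr _ _
  obtain ⟨f, hf, hfa⟩ := exists_relabel_circleLeft v a hl
  obtain ⟨g, hg, hgb⟩ := exists_relabel_circleRight v b hr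
  rw [mulChain_apply, hfa, hgb]
  have ha := CircleAlgebra.mul_map_eq
    ((CircleAlgebra.relabel ((orientedSum D₁ p₁ D₂ p₂).carry v w)).comp (CircleAlgebra.relabel f))
    (CircleAlgebra.relabel (circleLeft w))
    ((orientedSum D₁ p₁ D₂ p₂).edgeFactor (Sum.inr c) w) (fun z => by
      induction z using Quotient.inductionOn with
      | h e =>
        have h := KnotDiagram.edgeFactor_mul_carry _ hv hw (Sum.inl e)
        rw [← hf, ← circleLeft_circle] at h
        rw [AlgHom.comp_apply, CircleAlgebra.relabel_x, CircleAlgebra.relabel_x,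
          CircleAlgebra.relabel_x]
        exact h) (a (resLeft w))
  rw [AlgHom.comp_apply] at ha
  have hb := KnotDiagram.relabel_edgeMap _ (orientedSum D₁ p₁ D₂ p₂).toKnotDiagram Sum.inr
    rfl hw hv hw g hg (circleRight w) (circleRight_circle w) (relabel_circleRight_edgeFactor w c)
    (b (Function.update (resRight w) c false))
  exact (congrArg _ (mul_comm _ _)).trans ((KnotDiagram.edgeMap_mul _ ha).trans
    ((mul_comm _ _).trans (congrArg (_ * ·) hb)))

/-- The Leibniz rule. -/
theorem differential_mulChain (a : D₁.Chain) (b : D₂.Chain) :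
    (orientedSum D₁ p₁ D₂ p₂).differential (mulChain D₁ p₁ D₂ p₂ a b) =
      mulChain D₁ p₁ D₂ p₂ (D₁.differential a) b +
        mulChain D₁ p₁ D₂ p₂ a (D₂.differential b) := by
  funext w
  rw [KnotDiagram.differential_apply, Pi.add_apply, mulChain_apply, mulChain_apply,
    KnotDiagram.differential_apply, KnotDiagram.differential_apply, map_sum, map_sum,
    Finset.sum_mul, Finset.mul_sum]
  refine (Fintype.sum_sum_type _).trans (congrArg₂ (· + ·) ?_ ?_)
  · refine Finset.sum_congr rfl fun c _ => ?_
    rw [apply_ite (CircleAlgebra.relabel (circleLeft w)), map_zero, ite_mul, zero_mul]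
    refine if_ctx_congr Iff.rfl (fun hw => ?_) fun _ => rfl
    exact edgeMap_inl_mulChain a b rfl hw
  · refine Finset.sum_congr rfl fun c _ => ?_
    rw [apply_ite (CircleAlgebra.relabel (circleRight w)), map_zero, mul_ite, mul_zero]
    refine if_ctx_congr Iff.rfl (fun hw => ?_) fun _ => rfl
    exact edgeMap_inr_mulChain a b rfl hw

end differential

/-! ### The bigrading of a connected sum -/

theorem card_filter_sum {α β : Type} [Fintype α] [Fintype β] (f : α ⊕ β → Bool) (t : Bool) :
    (Finset.univ.filter fun c => f c = t).card =
      (Finset.univ.filter fun c => f (Sum.inl c) = t).card +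
        (Finset.univ.filter fun c => f (Sum.inr c) = t).card := by
  simp only [Finset.card_filter, Fintype.sum_sum_type]

theorem weight_orientedSum (v : (orientedSum D₁ p₁ D₂ p₂).Resolution) :
    (orientedSum D₁ p₁ D₂ p₂).weight v = D₁.weight (resLeft v) + D₂.weight (resRight v) :=
  card_filter_sum (α := D₁.Crossing) (β := D₂.Crossing) v true

theorem nPlus_orientedSum : (orientedSum D₁ p₁ D₂ p₂).nPlus = D₁.nPlus + D₂.nPlus :=
  card_filter_sum (Sum.elim D₁.positive D₂.positive) true

theorem nMinus_orientedSum : (orientedSum D₁ p₁ D₂ p₂).nMinus = D₁.nMinus + D₂.nMinus :=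
  card_filter_sum (Sum.elim D₁.positive D₂.positive) false

theorem grH_orientedSum (v : (orientedSum D₁ p₁ D₂ p₂).Resolution) :
    (orientedSum D₁ p₁ D₂ p₂).grH v = D₁.grH (resLeft v) + D₂.grH (resRight v) := by
  unfold KnotDiagram.grH
  rw [weight_orientedSum, nMinus_orientedSum]
  push_cast
  ring

/-- The loss of one circle is what the shift of the quantum grading compensates for. -/
theorem grOne_orientedSum (v : (orientedSum D₁ p₁ D₂ p₂).Resolution) :
    (orientedSum D₁ p₁ D₂ p₂).grOne v + 1 = D₁.grOne (resLeft v) + D₂.grOne (resRight v) := by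
  have h := card_circle v
  have h' : (Nat.card ((orientedSum D₁ p₁ D₂ p₂).Circle v) : ℤ) =
      Nat.card (D₁.Circle (resLeft v)) + Nat.card (D₂.Circle (resRight v)) - 1 := by
    rw [eq_sub_iff_add_eq]
    exact_mod_cast h
  unfold KnotDiagram.grOne
  rw [weight_orientedSum, nMinus_orientedSum, nPlus_orientedSum, h']
  push_cast
  ring

theorem mulChain_mem_homogeneous {a : D₁.Chain} {b : D₂.Chain} {i₁ i₂ j₁ j₂ : ℤ}
    (ha : a ∈ D₁.homogeneous i₁ j₁) (hb : b ∈ D₂.homogeneous i₂ j₂) :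
    mulChain D₁ p₁ D₂ p₂ a b ∈
      (orientedSum D₁ p₁ D₂ p₂).homogeneous (i₁ + i₂) (j₁ + j₂ - 1) := by
  refine D₁.map_mem_of_mem_homogeneous ((mulChain D₁ p₁ D₂ p₂).flip b) _
    (fun v₁ n₁ a hi₁ hj₁ ha => ?_) ha
  refine D₂.map_mem_of_mem_homogeneous
    (mulChain D₁ p₁ D₂ p₂ (Pi.single v₁ a)) _ (fun v₂ n₂ b hi₂ hj₂ hb => ?_) hb
  let v : (orientedSum D₁ p₁ D₂ p₂).Resolution := Sum.elim v₁ v₂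
  have hs := mulChain_single v a b
  have hH : (orientedSum D₁ p₁ D₂ p₂).grH v = D₁.grH v₁ + D₂.grH v₂ := grH_orientedSum v
  have hQ : (orientedSum D₁ p₁ D₂ p₂).grOne v + 1 = D₁.grOne v₁ + D₂.grOne v₂ :=
    grOne_orientedSum v
  change mulChain D₁ p₁ D₂ p₂ (Pi.single (resLeft v) a) (Pi.single (resRight v) b) ∈ _
  rw [hs]
  refine KnotDiagram.single_mem_homogeneous _ (by rw [hH, hi₁, hi₂]) ?_
    (CircleAlgebra.mul_mem_homogeneous (CircleAlgebra.relabel_mem_homogeneous _ ha)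
      (CircleAlgebra.relabel_mem_homogeneous _ hb))
  rw [← hj₁, ← hj₂]
  linear_combination hQ

/-! ### The reduced complex of a connected sum -/

/-- The inclusion of the unpointed algebra at one resolution into the unpointed reduced complex. -/
noncomputable def singleUnpointed (D : TransvergentDiagram) (v : D.Resolution) :
    CircleAlgebra.UnpointedAlgebra (D.Circle v) →ₗ[BNRing] D.unpointedReduced :=
  LinearMap.codRestrict D.unpointedReduced
    (LinearMap.single BNRing (fun v => CircleAlgebra (D.Circle v)) v ∘ₗ
      (CircleAlgebra.UnpointedAlgebra.val _).toLinearMap) fun a w _ => by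
    change (Pi.single v (CircleAlgebra.UnpointedAlgebra.val _ a) : D.Chain) w ∈
      CircleAlgebra.unpointed _
    by_cases h : w = v
    · subst h
      rw [Pi.single_eq_same]
      exact a.val_mem
    · rw [Pi.single_eq_of_ne h]
      exact zero_mem _

theorem singleUnpointed_coe (D : TransvergentDiagram) (v : D.Resolution)
    (a : CircleAlgebra.UnpointedAlgebra (D.Circle v)) :
    (singleUnpointed D v a : D.Chain) = Pi.single v (CircleAlgebra.UnpointedAlgebra.val _ a) := rfl

/-- The value of an element of the unpointed reduced complex at a resolution. -/
def evalUnpointed {D : TransvergentDiagram} (a : D.unpointedReduced) (v : D.Resolution) :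
    CircleAlgebra.UnpointedAlgebra (D.Circle v) := ⟨a.1 v, a.2 v (Set.mem_univ v)⟩

theorem sum_singleUnpointed {D : TransvergentDiagram} (a : D.unpointedReduced) :
    ∑ v, singleUnpointed D v (evalUnpointed a v) = a := by
  refine Subtype.ext ?_
  rw [AddSubmonoidClass.coe_finsetSum]
  exact Finset.univ_sum_single a.1

variable (D₁ p₁ D₂ p₂) in
/-- The product map on the tensor product of the unpointed reduced complexes. -/
noncomputable def joinReduced : D₁.unpointedReduced ⊗[BNRing] D₂.unpointedReduced →ₗ[BNRing]
    (orientedSum D₁ p₁ D₂ p₂).Chain :=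
  TensorProduct.lift ((mulChain D₁ p₁ D₂ p₂).compl₁₂ D₁.unpointedReduced.subtype
    D₂.unpointedReduced.subtype)

theorem joinReduced_tmul (a : D₁.unpointedReduced) (b : D₂.unpointedReduced) :
    joinReduced D₁ p₁ D₂ p₂ (a ⊗ₜ b) = mulChain D₁ p₁ D₂ p₂ a.1 b.1 := rfl

theorem joinReduced_mem (t : D₁.unpointedReduced ⊗[BNRing] D₂.unpointedReduced) :
    joinReduced D₁ p₁ D₂ p₂ t ∈ (orientedSum D₁ p₁ D₂ p₂).unpointedReduced := by
  induction t using TensorProduct.induction_on with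
  | zero => rw [map_zero]; exact zero_mem _
  | add s t hs ht => rw [map_add]; exact add_mem hs ht
  | tmul a b =>
    intro v _
    exact Subalgebra.mul_mem _ (CircleAlgebra.relabel_mem_unpointed _ (a.2 _ (Set.mem_univ _)))
      (CircleAlgebra.relabel_mem_unpointed _ (b.2 _ (Set.mem_univ _)))

variable (D₁ p₁ D₂ p₂) in
/-- The part at `v` of the inverse of `joinReduced`. -/
noncomputable def cutAt (v : (orientedSum D₁ p₁ D₂ p₂).Resolution) :
    CircleAlgebra ((orientedSum D₁ p₁ D₂ p₂).Circle v) →ₗ[BNRing]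
      D₁.unpointedReduced ⊗[BNRing] D₂.unpointedReduced :=
  TensorProduct.map (singleUnpointed D₁ (resLeft v)) (singleUnpointed D₂ (resRight v)) ∘ₗ
    (cutCircles v).toLinearMap

variable (D₁ p₁ D₂ p₂) in
/-- The inverse of `joinReduced`, defined on the whole Bar-Natan complex. -/
noncomputable def cutReduced : (orientedSum D₁ p₁ D₂ p₂).Chain →ₗ[BNRing]
    D₁.unpointedReduced ⊗[BNRing] D₂.unpointedReduced :=
  ∑ v, cutAt D₁ p₁ D₂ p₂ v ∘ₗ LinearMap.proj v

theorem cutReduced_apply (a : (orientedSum D₁ p₁ D₂ p₂).Chain) :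
    cutReduced D₁ p₁ D₂ p₂ a = ∑ v, cutAt D₁ p₁ D₂ p₂ v (a v) := by
  rw [cutReduced, LinearMap.sum_apply]
  rfl

theorem cutReduced_single (v : (orientedSum D₁ p₁ D₂ p₂).Resolution)
    (a : CircleAlgebra ((orientedSum D₁ p₁ D₂ p₂).Circle v)) :
    cutReduced D₁ p₁ D₂ p₂ (Pi.single v a) = cutAt D₁ p₁ D₂ p₂ v a := by
  rw [cutReduced_apply, Finset.sum_eq_single v]
  · rw [Pi.single_eq_same]
  · intro w _ hw
    rw [Pi.single_eq_of_ne hw, map_zero]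
  · intro h
    exact absurd (Finset.mem_univ v) h

theorem cutReduced_joinReduced (t : D₁.unpointedReduced ⊗[BNRing] D₂.unpointedReduced) :
    cutReduced D₁ p₁ D₂ p₂ (joinReduced D₁ p₁ D₂ p₂ t) = t := by
  induction t using TensorProduct.induction_on with
  | zero => rw [map_zero, map_zero]
  | add s t hs ht => rw [map_add, map_add, hs, ht]
  | tmul a b =>
    have h : ∀ v, cutAt D₁ p₁ D₂ p₂ v (joinReduced D₁ p₁ D₂ p₂ (a ⊗ₜ b) v) =
        singleUnpointed D₁ (resLeft v) (evalUnpointed a (resLeft v)) ⊗ₜ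
          singleUnpointed D₂ (resRight v) (evalUnpointed b (resRight v)) := by
      intro v
      have hj : joinReduced D₁ p₁ D₂ p₂ (a ⊗ₜ b) v =
          joinCircles v (evalUnpointed a (resLeft v) ⊗ₜ evalUnpointed b (resRight v)) := by
        rw [joinCircles_tmul]
        rfl
      rw [hj, cutAt, LinearMap.comp_apply, AlgHom.toLinearMap_apply, cutCircles_joinCircles,
        TensorProduct.map_tmul]
    rw [cutReduced_apply, Finset.sum_congr rfl fun v _ => h v]
    refine (Fintype.sum_equiv (Equiv.sumArrowEquivProdArrow D₁.Crossing D₂.Crossing Bool) _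
      (fun q => singleUnpointed D₁ q.1 (evalUnpointed a q.1) ⊗ₜ[BNRing]
        singleUnpointed D₂ q.2 (evalUnpointed b q.2)) (fun _ => rfl)).trans ?_
    have hb : ∀ q : D₁.Resolution, ∑ r, singleUnpointed D₁ q (evalUnpointed a q) ⊗ₜ[BNRing]
        singleUnpointed D₂ r (evalUnpointed b r) =
          singleUnpointed D₁ q (evalUnpointed a q) ⊗ₜ b := fun q => by
      rw [← TensorProduct.tmul_sum, sum_singleUnpointed]
    have ha : ∑ q, singleUnpointed D₁ q (evalUnpointed a q) ⊗ₜ[BNRing] b = a ⊗ₜ b := by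
      rw [← TensorProduct.sum_tmul, sum_singleUnpointed]
    exact (Fintype.sum_prod_type _).trans ((Finset.sum_congr rfl fun q _ => hb q).trans ha)

theorem joinReduced_cutAt {v : (orientedSum D₁ p₁ D₂ p₂).Resolution}
    {a : CircleAlgebra ((orientedSum D₁ p₁ D₂ p₂).Circle v)} (ha : a ∈ CircleAlgebra.unpointed _) :
    joinReduced D₁ p₁ D₂ p₂ (cutAt D₁ p₁ D₂ p₂ v a) = Pi.single v a := by
  have h : ∀ t, joinReduced D₁ p₁ D₂ p₂ (TensorProduct.map (singleUnpointed D₁ (resLeft v))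
      (singleUnpointed D₂ (resRight v)) t) = Pi.single v (joinCircles v t) := by
    intro t
    induction t using TensorProduct.induction_on with
    | zero => rw [map_zero, map_zero, map_zero, Pi.single_zero]
    | add s t hs ht => rw [map_add, map_add, map_add, hs, ht, Pi.single_add]
    | tmul a b =>
      rw [TensorProduct.map_tmul, joinReduced_tmul, singleUnpointed_coe, singleUnpointed_coe,
        mulChain_single, joinCircles_tmul]
  rw [cutAt, LinearMap.comp_apply, h, AlgHom.toLinearMap_apply, joinCircles_cutCircles v ha]

theorem joinReduced_cutReduced {a : (orientedSum D₁ p₁ D₂ p₂).Chain}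
    (ha : a ∈ (orientedSum D₁ p₁ D₂ p₂).unpointedReduced) :
    joinReduced D₁ p₁ D₂ p₂ (cutReduced D₁ p₁ D₂ p₂ a) = a := by
  rw [cutReduced_apply, map_sum,
    Finset.sum_congr rfl fun v _ => joinReduced_cutAt (ha v (Set.mem_univ v))]
  exact Finset.univ_sum_single a

theorem cutReduced_mem_homogeneous {a : (orientedSum D₁ p₁ D₂ p₂).Chain} {i j : ℤ}
    (ha : a ∈ (orientedSum D₁ p₁ D₂ p₂).homogeneous i (j + 1)) :
    cutReduced D₁ p₁ D₂ p₂ a ∈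
      ((D₁.reduced .unpointed).tensor (D₂.reduced .unpointed)).homogeneous i j := by
  refine KnotDiagram.map_mem_of_mem_homogeneous
    (M := D₁.unpointedReduced ⊗[BNRing] D₂.unpointedReduced) _ (cutReduced D₁ p₁ D₂ p₂) _
    (fun v n a hi hj ha => ?_) ha
  rw [cutReduced_single]
  have hle : CircleAlgebra.tensorHomogeneous (D₁.Circle (resLeft v)) (D₂.Circle (resRight v)) n ≤
      (((D₁.reduced .unpointed).tensor (D₂.reduced .unpointed)).homogeneous i j).comap
        (TensorProduct.map (singleUnpointed D₁ (resLeft v))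
          (singleUnpointed D₂ (resRight v))).toAddMonoidHom := by
    refine (AddSubgroup.closure_le _).2 ?_
    rintro _ ⟨m, k, a, b, rfl, ha, hb, rfl⟩
    have hQ := grOne_orientedSum v
    -- Both factors and the product are shifted by `-1`; the shift left over accounts for the circle
    -- that is lost in the connected sum.
    refine AddSubgroup.subset_closure ⟨D₁.grH (resLeft v), D₂.grH (resRight v),
      D₁.grOne (resLeft v) - 2 * m - 1, D₂.grOne (resRight v) - 2 * k - 1,
      singleUnpointed D₁ (resLeft v) a, singleUnpointed D₂ (resRight v) b,
      (grH_orientedSum v).symm.trans hi, ?_, ?_, ?_, rfl⟩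
    · linear_combination hj - hQ
    · exact D₁.single_mem_homogeneous rfl (by ring) ha
    · exact D₂.single_mem_homogeneous rfl (by ring) hb
  exact hle (cutCircles_mem_homogeneous v ha)

theorem joinReduced_mem_homogeneous {i j : ℤ}
    {t : D₁.unpointedReduced ⊗[BNRing] D₂.unpointedReduced}
    (ht : t ∈ ((D₁.reduced .unpointed).tensor (D₂.reduced .unpointed)).homogeneous i j) :
    joinReduced D₁ p₁ D₂ p₂ t ∈ (orientedSum D₁ p₁ D₂ p₂).homogeneous i (j + 1) := by
  have hle : ((D₁.reduced .unpointed).tensor (D₂.reduced .unpointed)).homogeneous i j ≤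
      ((orientedSum D₁ p₁ D₂ p₂).homogeneous i (j + 1)).comap
        (joinReduced D₁ p₁ D₂ p₂).toAddMonoidHom := by
    refine (AddSubgroup.closure_le _).2 ?_
    rintro _ ⟨i₁, i₂, j₁, j₂, a, b, rfl, rfl, ha, hb, rfl⟩
    have h := mulChain_mem_homogeneous (p₁ := p₁) (p₂ := p₂) ha hb
    have hj : j₁ + j₂ + 1 = j₁ + 1 + (j₂ + 1) - 1 := by ring
    rw [hj]
    exact h
  exact hle ht

theorem joinReduced_d (t : D₁.unpointedReduced ⊗[BNRing] D₂.unpointedReduced) :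
    joinReduced D₁ p₁ D₂ p₂ (((D₁.reduced .unpointed).tensor (D₂.reduced .unpointed)).d t) =
      (orientedSum D₁ p₁ D₂ p₂).differential (joinReduced D₁ p₁ D₂ p₂ t) := by
  have h : joinReduced D₁ p₁ D₂ p₂ ∘ₗ
      (TensorProduct.map (D₁.differential.restrict D₁.differential_mem_unpointedReduced)
          LinearMap.id +
        TensorProduct.map LinearMap.id
          (D₂.differential.restrict D₂.differential_mem_unpointedReduced)) =
      (orientedSum D₁ p₁ D₂ p₂).differential ∘ₗ joinReduced D₁ p₁ D₂ p₂ :=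
    TensorProduct.ext' fun a b => by
      rw [LinearMap.comp_apply, LinearMap.add_apply, map_add, TensorProduct.map_tmul,
        TensorProduct.map_tmul, joinReduced_tmul, joinReduced_tmul, LinearMap.comp_apply,
        joinReduced_tmul, differential_mulChain]
      rfl
  exact LinearMap.congr_fun h t

theorem joinReduced_tau (t : D₁.unpointedReduced ⊗[BNRing] D₂.unpointedReduced) :
    joinReduced D₁ p₁ D₂ p₂ (((D₁.reduced .unpointed).tensor (D₂.reduced .unpointed)).tau t) =
      (orientedSum D₁ p₁ D₂ p₂).tau (joinReduced D₁ p₁ D₂ p₂ t) := by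
  have h : joinReduced D₁ p₁ D₂ p₂ ∘ₗ
      TensorProduct.map (D₁.tau.restrict D₁.tau_mem_unpointedReduced)
        (D₂.tau.restrict D₂.tau_mem_unpointedReduced) =
      (orientedSum D₁ p₁ D₂ p₂).tau ∘ₗ joinReduced D₁ p₁ D₂ p₂ :=
    TensorProduct.ext' fun a b => by
      rw [LinearMap.comp_apply, TensorProduct.map_tmul, joinReduced_tmul, LinearMap.comp_apply,
        joinReduced_tmul, ← mulChain_tau]
      rfl
  exact LinearMap.congr_fun h t

variable (D₁ p₁ D₂ p₂) in
/-- The isomorphism for the unpointed reduced complexes and the oriented connected sum. -/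
noncomputable def orientedSumIso : InvolutiveComplex.EquivariantIso
    ((D₁.reduced .unpointed).tensor (D₂.reduced .unpointed))
    ((orientedSum D₁ p₁ D₂ p₂).reduced .unpointed) where
  toLinearEquiv :=
    { toFun := fun t =>
        (⟨joinReduced D₁ p₁ D₂ p₂ t, joinReduced_mem t⟩ :
          (orientedSum D₁ p₁ D₂ p₂).unpointedReduced)
      map_add' := fun s t => Subtype.ext (map_add (joinReduced D₁ p₁ D₂ p₂) s t)
      map_smul' := fun r t => Subtype.ext (map_smul (joinReduced D₁ p₁ D₂ p₂) r t)
      invFun := fun a => cutReduced D₁ p₁ D₂ p₂ a.1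
      left_inv := cutReduced_joinReduced
      right_inv := fun a => Subtype.ext (joinReduced_cutReduced a.2) }
  map_d t := Subtype.ext (joinReduced_d t)
  map_tau t := Subtype.ext (joinReduced_tau t)
  map_homogeneous i j t := by
    refine ⟨fun h => ?_, joinReduced_mem_homogeneous⟩
    have h' := cutReduced_mem_homogeneous (D₁ := D₁) (p₁ := p₁) (D₂ := D₂) (p₂ := p₂) h
    exact (cutReduced_joinReduced (p₁ := p₁) (p₂ := p₂) t) ▸ h'

end TransvergentDiagram

theorem theorem5 (D₁ D₂ : TransvergentDiagram) (h₁ : D₁.IsPlanar) (h₂ : D₂.IsPlanar)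
    (p₁ : D₁.FixedPoint) (p₂ : D₂.FixedPoint) (rotated : Bool)
    (m₁ : D₁.ReducedModel) (m₂ : D₂.ReducedModel)
    (m : (TransvergentDiagram.connectedSum D₁ p₁ D₂ p₂ rotated).ReducedModel) :
    Nonempty (InvolutiveComplex.EquivariantIso
      ((TransvergentDiagram.connectedSum D₁ p₁ D₂ p₂ rotated).reduced m)
      ((D₁.reduced m₁).tensor (D₂.reduced m₂))) := by
  obtain ⟨e⟩ := TransvergentDiagram.nonempty_iso_unpointed _ m
  obtain ⟨e₁⟩ := D₁.nonempty_iso_unpointed m₁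
  obtain ⟨e₂⟩ := D₂.nonempty_iso_unpointed m₂
  cases rotated with
  | false =>
    exact ⟨e.trans ((TransvergentDiagram.orientedSumIso D₁ p₁ D₂ p₂).symm.trans
      (e₁.symm.tensor e₂.symm))⟩
  | true =>
    exact ⟨e.trans ((TransvergentDiagram.orientedSumIso D₁ p₁ D₂.reverse p₂.reverse).symm.trans
      (e₁.symm.tensor (D₂.reverseIso.trans e₂.symm)))⟩
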